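/- **Theorem.** Let $\alpha:[0,\infty)\to(0,1)$ be locally integrable and suppose that the limits $\lim_{t\to0^+}\alpha(t)=\alpha'$ and $\lim_{t\to+\infty}\alpha(t)=\alpha''$ exist with $\alpha',\alpha''\in(0,1)$. Let $A(s)=\int_0^\infty e^{-st}\alpha(t)\,dt$, $s>0$, be the Laplace transform of $\alpha$, and suppose that $s\mapsto s^{sA(s)}$ is a Bernstein function on $(0,\infty)$, i.e. a non-negative $C^\infty$ function $g$ with $(-1)^{n-1}g^{(n)}(s)\ge 0$ for all $n\ge1$, $s>0$. Let $\lambda>0$. Then: 1. There is a function $\phi_A$ on $(0,\infty)$ with $\int_0^\infty e^{-st}\phi_A(t)\,dt=s^{sA(s)-1}$ (absolutely convergent) for every $s>0$. For such a $\phi_A$, define the Scarpi variable-order derivative of a locally absolutely continuous function $f$ on $[0,\infty)$ by $D_t^{\alpha(t)}f(t)=\int_0^t\phi_A(t-\tau)f'(\tau)\,d\tau$, which is defined for almost every $t>0$. 2. For every such $\phi_A$ there is exactly one function $u_A:[0,\infty)\to\mathbb R$, absolutely continuous on every $[0,T]$, $0<T<\infty$, with $$D_t^{\alpha(t)}u_A(t)=-\lambda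 u_A(t)\ \text{ for almost every } t>0,\qquad u_A(0)=1.$$ Its Laplace transform is $\widetilde u_A(s)=\dfrac{s^{sA(s)-1}}{\lambda+s^{sA(s)}}$, $s>0$. 3. The solution $u_A$ is non-negative, non-increasing and right-continuous on $[0,\infty)$, and $\lim_{t\to0^+}u_A(t)=1$. 4. There is a random variable $Z_A>0$ with $P(Z_A>t)=u_A(t)$ for every $t\ge0$. -/

import Mathlib

open MeasureTheory Set Filter Topology
open scoped ContDiff

noncomputable section

/-- The (one-sided) Laplace transform `s ↦ ∫₀^∞ e^{-st} g(t) dt`. -/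
def laplaceTransform (g : ℝ → ℝ) (s : ℝ) : ℝ :=
  ∫ t in Ioi (0 : ℝ), Real.exp (-(s * t)) * g t

/-- `g` has an absolutely convergent Laplace transform on `(0, ∞)`, equal to `G` there. -/
def HasLaplaceTransform (g G : ℝ → ℝ) : Prop :=
  ∀ s : ℝ, 0 < s →
    IntegrableOn (fun t => Real.exp (-(s * t)) * g t) (Ioi 0) ∧ laplaceTransform g s = G s

/-- Bernstein functions on `(0, ∞)`: smooth, non-negative, and
`(-1)^(n-1) g^(n) ≥ 0` for every `n ≥ 1` (here `n` is shifted by one). -/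
def IsBernsteinFunction (g : ℝ → ℝ) : Prop :=
  ContDiffOn ℝ ∞ g (Ioi 0) ∧
  (∀ x : ℝ, 0 < x → 0 ≤ g x) ∧
  ∀ n : ℕ, ∀ x : ℝ, 0 < x → 0 ≤ (-1 : ℝ) ^ n * iteratedDeriv (n + 1) g x

/-- The function `s ↦ s^{s A(s)}`, where `A` is the Laplace transform of `α`. -/
def scarpiSymbol (α : ℝ → ℝ) (s : ℝ) : ℝ :=
  s ^ (s * laplaceTransform α s)

/-- `φ` is the kernel of the Scarpi derivative of order `α(t)`: the inverse Laplace transform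
of `s ↦ s^{s A(s) - 1}`. -/
def IsScarpiKernel (α φ : ℝ → ℝ) : Prop :=
  HasLaplaceTransform φ (fun s => s ^ (s * laplaceTransform α s - 1))

/-- The variable-order Caputo-type (Scarpi) derivative with kernel `φ`:
`D f(t) = ∫₀ᵗ φ(t - τ) f'(τ) dτ`. -/
def scarpiDeriv (φ f : ℝ → ℝ) (t : ℝ) : ℝ :=
  ∫ τ in (0 : ℝ)..t, φ (t - τ) * deriv f τ

/-- `u` solves `D u = -lam u` on `[0, ∞)` with `u(0) = 1`: it is absolutely continuous on every
`[0, T]`, and for almost every `t > 0` the integral defining `D u(t)` converges and the equation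
holds. -/
structure IsRelaxationSolution (φ : ℝ → ℝ) (lam : ℝ) (u : ℝ → ℝ) : Prop where
  absolutelyContinuous : ∀ T : ℝ, 0 < T → AbsolutelyContinuousOnInterval u 0 T
  initial : u 0 = 1
  equation : ∀ᵐ t ∂(volume.restrict (Ioi (0 : ℝ))),
    IntervalIntegrable (fun τ => φ (t - τ) * deriv u τ) volume 0 t ∧
      scarpiDeriv φ u t = -lam * u t

end

/-! Write g(s) = s^{sA(s)}. By an Abelian argument sA(s) tends to α' as s → ∞ and to α'' as s → 0+.
Hence g(0+) = 0, g(s)/s → 0 at infinity, and g grows like s^{α' + o(1)} with 0 < α' < 1.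

Kernel: g' is completely monotone, so by Bernstein's theorem it is the Laplace transform of a
measure m on [0, ∞). Since g(s)/s → 0, m has no atom at 0, and φ(t) = ∫_{r>t} r⁻¹ m(dr) has
transform g(s)/s.

Solution: under the Laplace transform the equation says that -u' has transform λ/(λ + g). This is
the transform of the law μ of a subordinator with exponent g, stopped at an independent exponential
time of rate λ, so u(t) = μ((t, ∞)). Monotonicity, sign and the random variable are then immediate.

The crux is that u must be absolutely continuous, that is, μ must have a density
(`exists_resolvent`). Growth of g forces the characteristic function of the subordinator law P_t to
be O(y⁻²), so P_t has a density for each t > 0 (`IsSubordinator.absolutelyContinuous`). Splitting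
the exponential time at δ gives μ = μ₁ + e^{-λδ} (μ ∗ P_δ), where μ₁ has mass 1 - e^{-λδ}. The
second term is absolutely continuous, so letting δ → 0 shows that μ is too.

Uniqueness (`IsRelaxationSolution.eqOn`) cannot transform an arbitrary solution, which may grow too
fast. Its derivative is cut off at T, and causality of convolution removes the error on (0, T]. -/

noncomputable section

/-! ### Bernstein's theorem on Taylor series with non-negative derivatives -/

section AbsolutelyMonotoneSeries

variable {F : ℕ → ℝ → ℝ} {c : ℝ}

/-- The remainder of order `n` of the Taylor expansion at `0` of `F m`, where `F (k + 1)` is the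
derivative of `F k`. -/
def taylorRemainder (F : ℕ → ℝ → ℝ) (n m : ℕ) (h : ℝ) : ℝ :=
  F m h - ∑ k ∈ Finset.range n, F (m + k) 0 * h ^ k / (k.factorial : ℝ)

theorem hasDerivAt_taylorRemainder
    (hd : ∀ k, ∀ h ∈ Ico 0 c, HasDerivAt (F k) (F (k + 1) h) h) (n m : ℕ) {h : ℝ}
    (hh : h ∈ Ico 0 c) :
    HasDerivAt (taylorRemainder F (n + 1) m) (taylorRemainder F n (m + 1) h) h := by
  unfold taylorRemainder
  refine (hd m h hh).sub ?_
  simp_rw [Finset.sum_range_succ']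
  have h2 : HasDerivAt
      (fun x : ℝ => ∑ k ∈ Finset.range n, F (m + (k + 1)) 0 * x ^ (k + 1) / ((k + 1).factorial : ℝ))
      (∑ k ∈ Finset.range n, F (m + 1 + k) 0 * h ^ k / (k.factorial : ℝ)) h := by
    refine HasDerivAt.fun_sum fun k _ => ?_
    have := ((hasDerivAt_pow (k + 1) h).const_mul (F (m + (k + 1)) 0)).div_const
      ((k + 1).factorial : ℝ)
    convert! this using 1
    rw [Nat.factorial_succ, show m + 1 + k = m + (k + 1) by ring]
    push_cast
    have : ((k.factorial : ℕ) : ℝ) ≠ 0 := by positivity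
    have : ((k : ℝ) + 1) ≠ 0 := by positivity
    field_simp
  simpa using h2.add_const (F m 0)

theorem nonneg_of_hasDerivAt_nonneg {D D' : ℝ → ℝ}
    (hd : ∀ h ∈ Ico 0 c, HasDerivAt D (D' h) h) (h0 : 0 ≤ D 0)
    (hp : ∀ h ∈ Ico 0 c, 0 ≤ D' h) {h : ℝ} (hh : h ∈ Ico 0 c) : 0 ≤ D h := by
  have hm : MonotoneOn D (Ico 0 c) := by
    refine monotoneOn_of_deriv_nonneg (convex_Ico 0 c)
      (fun x hx => (hd x hx).continuousAt.continuousWithinAt)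
      (fun x hx => (hd x (interior_subset hx)).differentiableAt.differentiableWithinAt)
      fun x hx => ?_
    rw [(hd x (interior_subset hx)).deriv]
    exact hp x (interior_subset hx)
  exact h0.trans (hm ⟨le_rfl, hh.1.trans_lt hh.2⟩ hh hh.1)

theorem taylorRemainder_zero (n m : ℕ) : taylorRemainder F (n + 1) m 0 = 0 := by
  unfold taylorRemainder
  rw [Finset.sum_range_succ']
  simp

theorem taylorRemainder_nonneg
    (hd : ∀ k, ∀ h ∈ Ico 0 c, HasDerivAt (F k) (F (k + 1) h) h)
    (hp : ∀ k, ∀ h ∈ Ico 0 c, 0 ≤ F k h) (n m : ℕ) {h : ℝ}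
    (hh : h ∈ Ico 0 c) : 0 ≤ taylorRemainder F n m h := by
  induction n generalizing m h with
  | zero => simpa [taylorRemainder] using hp m h hh
  | succ n ih =>
    exact nonneg_of_hasDerivAt_nonneg (fun x hx => hasDerivAt_taylorRemainder hd n m hx)
      (taylorRemainder_zero n m).ge (fun x hx => ih (m + 1) hx) hh

/-- The quotient of the remainder by h ^ n is non-decreasing: differentiating the difference of the
two sides reproduces, up to a factor `q`, the same inequality one order lower. The base case is
monotonicity of `F m`. -/
theorem taylorRemainder_mul_le
    (hd : ∀ k, ∀ h ∈ Ico 0 c, HasDerivAt (F k) (F (k + 1) h) h)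
    (hp : ∀ k, ∀ h ∈ Ico 0 c, 0 ≤ F k h) {q : ℝ} (hq : q ∈ Icc (0 : ℝ) 1) (n m : ℕ) {h : ℝ}
    (hh : h ∈ Ico 0 c) :
    taylorRemainder F (n + 1) m (q * h) ≤ q ^ n * taylorRemainder F (n + 1) m h := by
  have hmem : ∀ x ∈ Ico 0 c, q * x ∈ Ico 0 c := fun x hx =>
    ⟨mul_nonneg hq.1 hx.1, (mul_le_of_le_one_left hx.1 hq.2).trans_lt hx.2⟩
  have key : ∀ n m, ∀ x ∈ Ico 0 c,
      HasDerivAt (fun h => q ^ n * taylorRemainder F (n + 1) m h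
        - taylorRemainder F (n + 1) m (q * h))
        (q ^ n * taylorRemainder F n (m + 1) x - taylorRemainder F n (m + 1) (q * x) * q) x := by
    intro n m x hx
    refine ((hasDerivAt_taylorRemainder hd n m hx).const_mul _).sub ?_
    have := (hasDerivAt_taylorRemainder hd n m (hmem x hx)).comp x
      ((hasDerivAt_id x).const_mul q)
    simpa [Function.comp_def] using this
  induction n generalizing m h with
  | zero =>
    have hm : MonotoneOn (F m) (Ico 0 c) := by
      refine monotoneOn_of_deriv_nonneg (convex_Ico 0 c)
        (fun x hx => (hd m x hx).continuousAt.continuousWithinAt)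
        (fun x hx => (hd m x (interior_subset hx)).differentiableAt.differentiableWithinAt)
        fun x hx => ?_
      rw [(hd m x (interior_subset hx)).deriv]
      exact hp (m + 1) x (interior_subset hx)
    have := hm (hmem h hh) hh (mul_le_of_le_one_left hh.1 hq.2)
    simpa [taylorRemainder] using this
  | succ n ih =>
    rw [← sub_nonneg]
    refine nonneg_of_hasDerivAt_nonneg (key (n + 1) m) ?_ (fun x hx => ?_) hh
    · simp [taylorRemainder_zero]
    · have h1 := mul_le_mul_of_nonneg_left (ih (m + 1) hx) hq.1
      rw [pow_succ']
      linarith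

/-- Bernstein: a function all of whose derivatives are nonnegative on `[0, c)` is the sum of its
Taylor series at `0`. -/
theorem hasSum_taylor_of_nonneg
    (hd : ∀ k, ∀ h ∈ Ico 0 c, HasDerivAt (F k) (F (k + 1) h) h)
    (hp : ∀ k, ∀ h ∈ Ico 0 c, 0 ≤ F k h) {h : ℝ} (hh : h ∈ Ico 0 c) :
    HasSum (fun k => F k 0 * h ^ k / (k.factorial : ℝ)) (F 0 h) := by
  have h0c : (0 : ℝ) ∈ Ico 0 c := ⟨le_rfl, hh.1.trans_lt hh.2⟩
  rw [hasSum_iff_tendsto_nat_of_nonneg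
    (fun k => div_nonneg (mul_nonneg (hp k 0 h0c) (pow_nonneg hh.1 k)) (by positivity))]
  -- Room to the right of `h` makes the ratio h/h' less than 1, so the remainder at `h` is at most
  -- (h/h')^n F 0 h' and decays geometrically.
  obtain ⟨h', h1, h2⟩ := exists_between hh.2
  have h'pos : 0 < h' := hh.1.trans_lt h1
  have hq0 : 0 ≤ h / h' := div_nonneg hh.1 h'pos.le
  have hq1 : h / h' < 1 := (div_lt_one h'pos).2 h1
  have hqh : h / h' * h' = h := div_mul_cancel₀ h h'pos.ne'
  have hR : Tendsto (fun n => taylorRemainder F (n + 1) 0 h) atTop (𝓝 0) := by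
    refine tendsto_of_tendsto_of_tendsto_of_le_of_le tendsto_const_nhds
      (?_ : Tendsto (fun n => (h / h') ^ n * F 0 h') atTop (𝓝 0))
      (fun n => taylorRemainder_nonneg hd hp _ _ hh) fun n => ?_
    · simpa using (tendsto_pow_atTop_nhds_zero_of_lt_one hq0 hq1).mul_const (F 0 h')
    · have := taylorRemainder_mul_le hd hp ⟨hq0, hq1.le⟩ n 0 (h := h') ⟨h'pos.le, h2⟩
      rw [hqh] at this
      refine this.trans (mul_le_mul_of_nonneg_left ?_ (by positivity))
      unfold taylorRemainder
      rw [sub_le_self_iff]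
      exact Finset.sum_nonneg fun k _ =>
        div_nonneg (mul_nonneg (hp _ 0 h0c) (pow_nonneg h'pos.le k)) (by positivity)
  rw [← tendsto_add_atTop_iff_nat 1]
  have := (tendsto_const_nhds (x := F 0 h)).sub hR
  simpa [taylorRemainder] using this

end AbsolutelyMonotoneSeries

/-! ### Completely monotone functions and their expansions -/

/-- Completely monotone functions on `(0, ∞)`. -/
structure IsCompletelyMonotone (f : ℝ → ℝ) : Prop where
  contDiffOn : ContDiffOn ℝ ∞ f (Ioi 0)
  nonneg : ∀ n : ℕ, ∀ x : ℝ, 0 < x → 0 ≤ (-1 : ℝ) ^ n * iteratedDeriv n f x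

theorem ContDiffOn.hasDerivAt_iteratedDeriv {f : ℝ → ℝ} (hf : ContDiffOn ℝ ∞ f (Ioi 0)) (n : ℕ)
    {x : ℝ} (hx : 0 < x) : HasDerivAt (iteratedDeriv n f) (iteratedDeriv (n + 1) f x) x := by
  have h1 : ContDiffAt ℝ ∞ f x := hf.contDiffAt (Ioi_mem_nhds hx)
  rw [iteratedDeriv_succ]
  refine DifferentiableAt.hasDerivAt ?_
  have := h1.contDiffWithinAt (s := univ) |>.differentiableWithinAt_iteratedDerivWithin (m := n)
    (mod_cast WithTop.coe_lt_top _) (by simp)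
  rwa [iteratedDerivWithin_univ, differentiableWithinAt_univ] at this

namespace IsCompletelyMonotone

variable {f : ℝ → ℝ}

theorem nonneg' (hf : IsCompletelyMonotone f) {x : ℝ} (hx : 0 < x) : 0 ≤ f x := by
  simpa using hf.nonneg 0 x hx

/-- Reflection at `b` turns complete monotonicity into non-negativity of all derivatives, so the
Taylor series at `b` converges down to 0. As b → ∞ the factor (1 - s/b)^k resembles e^{-sk/b}, which
makes this a discrete approximation of the Bernstein representation. -/
theorem hasSum (hf : IsCompletelyMonotone f) {b : ℝ} {s : ℝ} (hs : 0 < s) (hsb : s ≤ b) :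
    HasSum (fun k => ((-1 : ℝ) ^ k * iteratedDeriv k f b * b ^ k / (k.factorial : ℝ)) *
      (1 - s / b) ^ k) (f s) := by
  have hb : 0 < b := hs.trans_le hsb
  have := hasSum_taylor_of_nonneg (c := b)
    (F := fun k h => (-1 : ℝ) ^ k * iteratedDeriv k f (b - h)) (h := b - s) ?_ ?_ ?_
  · convert! this using 1
    · ext k
      have : b - s = b * (1 - s / b) := by field_simp
      rw [this, mul_pow, sub_zero]
      ring
    · simp
  · intro k h hh
    have h1 := (hf.contDiffOn.hasDerivAt_iteratedDeriv k (x := b - h) (by linarith [hh.2])).comp h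
      ((hasDerivAt_id h).const_sub b)
    convert! h1.const_mul ((-1 : ℝ) ^ k) using 1
    ring
  · intro k h hh
    exact hf.nonneg k _ (by linarith [hh.2])
  · exact ⟨by linarith, by linarith⟩

theorem continuousAt (hf : IsCompletelyMonotone f) {x : ℝ} (hx : 0 < x) : ContinuousAt f x :=
  (hf.contDiffOn.contDiffAt (Ioi_mem_nhds hx)).continuousAt

theorem antitoneOn (hf : IsCompletelyMonotone f) : AntitoneOn f (Ioi 0) := by
  refine antitoneOn_of_deriv_nonpos (convex_Ioi 0)
    (fun x hx => (hf.continuousAt hx).continuousWithinAt)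
    (fun x hx => ?_) fun x hx => ?_
  · rw [interior_Ioi] at hx
    have := hf.contDiffOn.hasDerivAt_iteratedDeriv 0 hx
    rw [iteratedDeriv_zero] at this
    exact this.differentiableAt.differentiableWithinAt
  · rw [interior_Ioi] at hx
    have := hf.nonneg 1 x hx
    rw [iteratedDeriv_one] at this
    linarith

theorem le_of_tendsto (hf : IsCompletelyMonotone f) {M : ℝ} (hM : Tendsto f (𝓝[>] 0) (𝓝 M))
    {s : ℝ} (hs : 0 < s) : f s ≤ M := by
  refine ge_of_tendsto hM ?_
  filter_upwards [Ioo_mem_nhdsGT hs] with x hx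
  exact hf.antitoneOn hx.1 hs hx.2.le

/-- The weights of the expansion of a completely monotone function at `b` sum up to its limit
at `0`. -/
theorem hasSum_weights (hf : IsCompletelyMonotone f) {M : ℝ} (hM : Tendsto f (𝓝[>] 0) (𝓝 M))
    {b : ℝ} (hb : 0 < b) :
    HasSum (fun k => (-1 : ℝ) ^ k * iteratedDeriv k f b * b ^ k / (k.factorial : ℝ)) M := by
  set a : ℕ → ℝ := fun k => (-1 : ℝ) ^ k * iteratedDeriv k f b * b ^ k / (k.factorial : ℝ) with ha
  have ha0 : ∀ k, 0 ≤ a k := fun k =>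
    div_nonneg (mul_nonneg (hf.nonneg k b hb) (by positivity)) (by positivity)
  have hpart : ∀ u : Finset ℕ, ∑ k ∈ u, a k ≤ M := by
    intro u
    have h1 : Tendsto (fun s : ℝ => ∑ k ∈ u, a k * (1 - s / b) ^ k) (𝓝[>] 0)
        (𝓝 (∑ k ∈ u, a k)) := by
      have : Continuous (fun s : ℝ => ∑ k ∈ u, a k * (1 - s / b) ^ k) := by fun_prop
      have := (this.tendsto 0).mono_left (nhdsWithin_le_nhds (s := Ioi 0))
      simpa using this
    refine le_of_tendsto_of_tendsto h1 hM ?_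
    filter_upwards [Ioo_mem_nhdsGT hb] with s hs
    refine sum_le_hasSum u (fun k _ => ?_) (hf.hasSum hs.1 hs.2.le)
    refine mul_nonneg (ha0 k) (pow_nonneg ?_ k)
    rw [sub_nonneg, div_le_one hb]
    exact hs.2.le
  have hsum : Summable a := summable_of_sum_le ha0 hpart
  have hle : ∑' k, a k ≤ M := hsum.tsum_le_of_sum_le hpart
  have hge : M ≤ ∑' k, a k := by
    refine _root_.le_of_tendsto hM ?_
    filter_upwards [Ioo_mem_nhdsGT hb] with s hs
    refine hasSum_le (fun k => ?_) (hf.hasSum hs.1 hs.2.le) hsum.hasSum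
    refine mul_le_of_le_one_right (ha0 k) (pow_le_one₀ ?_ ?_)
    · rw [sub_nonneg, div_le_one hb]
      exact hs.2.le
    · have := div_nonneg hs.1.le hb.le
      linarith
  have := hsum.hasSum
  rwa [le_antisymm hle hge] at this

end IsCompletelyMonotone

/-! ### The Hausdorff–Bernstein–Widder theorem -/

/-- Uniformity in `k` is the point: the difference of the bases is at most v², and the factor k from
the difference of powers is absorbed by kv e^{-kv} ≤ 1. -/
theorem abs_one_sub_pow_sub_exp_le {v : ℝ} (hv0 : 0 ≤ v) (hv1 : v ≤ 1) (k : ℕ) :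
    |(1 - v) ^ k - Real.exp (-(v * k))| ≤ 3 * v := by
  have hx : 1 - v ≤ Real.exp (-v) := by linarith [Real.add_one_le_exp (-v)]
  have hx2 : Real.exp (-v) - (1 - v) ≤ v ^ 2 := by
    have := Real.abs_exp_sub_one_sub_id_le (x := -v) (by rw [abs_neg, abs_of_nonneg hv0]; exact hv1)
    have := (abs_le.1 this).2
    nlinarith
  have hpow : (1 - v) ^ k ≤ Real.exp (-v) ^ k := pow_le_pow_left₀ (by linarith) hx k
  have hexp : Real.exp (-(v * k)) = Real.exp (-v) ^ k := by
    rw [← Real.exp_nat_mul]; ring_nf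
  rw [hexp, abs_sub_comm, abs_of_nonneg (by linarith)]
  rcases k with _ | k
  · simp; linarith
  · have h1 : Real.exp (-v) ^ (k + 1) - (1 - v) ^ (k + 1)
        ≤ (k + 1) * Real.exp (-v) ^ k * v ^ 2 := by
      have hg := Commute.geom_sum₂_mul (Commute.all (Real.exp (-v)) (1 - v)) (k + 1)
      rw [← hg]
      have : ∑ i ∈ Finset.range (k + 1), Real.exp (-v) ^ i * (1 - v) ^ (k + 1 - 1 - i)
          ≤ (k + 1) * Real.exp (-v) ^ k := by
        calc _ ≤ ∑ i ∈ Finset.range (k + 1), Real.exp (-v) ^ k := by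
              refine Finset.sum_le_sum fun i hi => ?_
              have hik : i ≤ k := Nat.lt_succ_iff.1 (Finset.mem_range.1 hi)
              calc _ ≤ Real.exp (-v) ^ i * Real.exp (-v) ^ (k - i) := by
                    refine mul_le_mul_of_nonneg_left ?_ (by positivity)
                    exact pow_le_pow_left₀ (by linarith) hx _
                _ = Real.exp (-v) ^ k := by rw [← pow_add, Nat.add_sub_cancel' hik]
          _ = (k + 1) * Real.exp (-v) ^ k := by simp
      exact mul_le_mul this hx2 (by linarith) (by positivity)
    have h2 : (k * v) * Real.exp (-v) ^ k ≤ 1 := by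
      rw [← Real.exp_nat_mul, show (k : ℝ) * -v = -(k * v) by ring, Real.exp_neg,
        ← div_eq_mul_inv, div_le_one (Real.exp_pos _)]
      linarith [Real.add_one_le_exp ((k : ℝ) * v)]
    have h3 : Real.exp (-v) ^ k ≤ 1 := pow_le_one₀ (by positivity) (Real.exp_le_one_iff.2 (by linarith))
    have h4 : (0 : ℝ) < Real.exp (-v) ^ k := by positivity
    push_cast at *
    nlinarith [mul_le_mul_of_nonneg_left h2 hv0, mul_le_mul_of_nonneg_left h3 (sq_nonneg v)]

/-- The Laplace transform of a measure. -/
def measureLaplace (μ : Measure ℝ) (s : ℝ) : ℝ := ∫ t, Real.exp (-(s * t)) ∂μ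

namespace IsCompletelyMonotone

variable {f : ℝ → ℝ}

/-- The measure puts the Taylor weight a_k at x = e^{-k/b}. The variable x = e^{-t} makes the state
space [0, 1] compact, so no tightness is needed in the limit. -/
theorem exists_approx_probabilityMeasure (hf : IsCompletelyMonotone f)
    (hM : Tendsto f (𝓝[>] 0) (𝓝 1)) {b : ℝ} (hb : 0 < b) :
    ∃ ρ : ProbabilityMeasure (Icc (0 : ℝ) 1), ∀ s, 0 < s → s ≤ b →
      |f s - ∫ x, (x : ℝ) ^ s ∂(ρ : Measure (Icc (0 : ℝ) 1))| ≤ 3 * (s / b) := by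
  set a : ℕ → ℝ := fun k => (-1 : ℝ) ^ k * iteratedDeriv k f b * b ^ k / (k.factorial : ℝ) with ha
  have ha0 : ∀ k, 0 ≤ a k := fun k =>
    div_nonneg (mul_nonneg (hf.nonneg k b hb) (by positivity)) (by positivity)
  have hasum : HasSum a 1 := hf.hasSum_weights hM hb
  let p : PMF ℕ := ⟨fun k => ENNReal.ofReal (a k), by
    rw [ENNReal.summable.hasSum_iff, ← ENNReal.ofReal_tsum_of_nonneg ha0 hasum.summable,
      hasum.tsum_eq, ENNReal.ofReal_one]⟩
  let x : ℕ → Icc (0 : ℝ) 1 := fun k => ⟨Real.exp (-(k / b)), (Real.exp_pos _).le,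
    Real.exp_le_one_iff.2 (neg_nonpos.2 (by positivity))⟩
  have hxm : Measurable x := measurable_of_countable x
  refine ⟨⟨p.toMeasure.map x, Measure.isProbabilityMeasure_map hxm.aemeasurable⟩,
    fun s hs hsb => ?_⟩
  have hcont : Continuous fun y : Icc (0 : ℝ) 1 => (y : ℝ) ^ s :=
    (Real.continuous_rpow_const hs.le).comp continuous_subtype_val
  have hle : ∀ y : Icc (0 : ℝ) 1, ‖(y : ℝ) ^ s‖ ≤ 1 := fun y => by
    rw [Real.norm_of_nonneg (Real.rpow_nonneg y.2.1 s)]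
    exact Real.rpow_le_one y.2.1 y.2.2 hs.le
  have hterm : ∀ k : ℕ, ((x k : Icc (0 : ℝ) 1) : ℝ) ^ s = Real.exp (-(s / b * k)) := fun k => by
    change Real.exp _ ^ s = _
    rw [← Real.exp_mul]
    congr 1
    ring
  have hint : ∫ y, (y : ℝ) ^ s ∂(p.toMeasure.map x) = ∑' k, a k * Real.exp (-(s / b * k)) := by
    rw [integral_map hxm.aemeasurable hcont.aestronglyMeasurable, PMF.integral_eq_tsum]
    · refine tsum_congr fun k => ?_
      rw [hterm, smul_eq_mul]
      congr 1
      exact ENNReal.toReal_ofReal (ha0 k)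
    · exact Integrable.of_bound (hcont.measurable.comp hxm).aestronglyMeasurable 1
        (ae_of_all _ fun k => hle (x k))
  change |f s - ∫ y, (y : ℝ) ^ s ∂(p.toMeasure.map x)| ≤ _
  have hsum2 : Summable fun k : ℕ => a k * Real.exp (-(s / b * k)) := by
    refine Summable.of_nonneg_of_le (fun k => mul_nonneg (ha0 k) (Real.exp_pos _).le)
      (fun k => mul_le_of_le_one_right (ha0 k) (Real.exp_le_one_iff.2 ?_)) hasum.summable
    rw [neg_nonpos]
    positivity
  have hdiff := (hf.hasSum hs hsb).sub hsum2.hasSum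
  rw [← hint] at hdiff
  have hv0 : 0 ≤ s / b := by positivity
  have hv1 : s / b ≤ 1 := (div_le_one hb).2 hsb
  have hk : ∀ k : ℕ, |a k * (1 - s / b) ^ k - a k * Real.exp (-(s / b * k))|
      ≤ a k * (3 * (s / b)) := fun k => by
    rw [← mul_sub, abs_mul, abs_of_nonneg (ha0 k)]
    exact mul_le_mul_of_nonneg_left (abs_one_sub_pow_sub_exp_le hv0 hv1 k) (ha0 k)
  have hbd : HasSum (fun k => a k * (3 * (s / b))) (3 * (s / b)) := by
    simpa using hasum.mul_right (3 * (s / b))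
  rw [abs_le]
  exact ⟨hasSum_le (fun k => (abs_le.1 (hk k)).1) hbd.neg hdiff,
    hasSum_le (fun k => (abs_le.1 (hk k)).2) hdiff hbd⟩

theorem exists_probabilityMeasure_Icc (hf : IsCompletelyMonotone f)
    (hM : Tendsto f (𝓝[>] 0) (𝓝 1)) :
    ∃ ρ : ProbabilityMeasure (Icc (0 : ℝ) 1), ∀ s, 0 < s →
      ∫ x, (x : ℝ) ^ s ∂(ρ : Measure (Icc (0 : ℝ) 1)) = f s := by
  choose ρ hρ using fun n : ℕ => hf.exists_approx_probabilityMeasure hM (b := n + 1) (by positivity)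
  -- Probability measures on [0, 1] form a compact space, so an ultrafilter limit exists without
  -- extracting a subsequence.
  set U := (hyperfilter ℕ).map ρ with hU
  refine ⟨U.lim, fun s hs => ?_⟩
  have h1 : Tendsto ρ (hyperfilter ℕ) (𝓝 U.lim) := U.le_nhds_lim
  rw [ProbabilityMeasure.tendsto_iff_forall_integral_tendsto] at h1
  have hcont : Continuous fun y : Icc (0 : ℝ) 1 => (y : ℝ) ^ s :=
    (Real.continuous_rpow_const hs.le).comp continuous_subtype_val
  have h2 := h1 (BoundedContinuousFunction.mkOfCompact ⟨_, hcont⟩)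
  refine tendsto_nhds_unique h2 ?_
  refine Tendsto.mono_left ?_ Nat.hyperfilter_le_atTop
  rw [tendsto_iff_norm_sub_tendsto_zero]
  refine squeeze_zero' (Eventually.of_forall fun _ => norm_nonneg _) (g := fun n : ℕ => 3 * (s / (n + 1)))
    ?_ ?_
  · filter_upwards [eventually_ge_atTop ⌈s⌉₊] with n hn
    rw [norm_sub_rev]
    refine hρ n s hs ?_
    have := Nat.le_of_ceil_le hn
    linarith
  · have h3 : Tendsto (fun n : ℕ => s / ((n : ℝ) + 1)) atTop (𝓝 0) :=
      tendsto_const_nhds.div_atTop (tendsto_atTop_add_const_right _ _ tendsto_natCast_atTop_atTop)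
    simpa using h3.const_mul 3

/-- The Hausdorff–Bernstein–Widder theorem, normalized. -/
theorem exists_probabilityMeasure (hf : IsCompletelyMonotone f)
    (hM : Tendsto f (𝓝[>] 0) (𝓝 1)) :
    ∃ μ : Measure ℝ, IsProbabilityMeasure μ ∧ μ (Iio 0) = 0 ∧
      ∀ s, 0 < s → measureLaplace μ s = f s := by
  obtain ⟨ρ, hρ⟩ := hf.exists_probabilityMeasure_Icc hM
  set P : Measure (Icc (0 : ℝ) 1) := (ρ : Measure (Icc (0 : ℝ) 1)) with hP
  let S : Set (Icc (0 : ℝ) 1) := {x | 0 < (x : ℝ)}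
  have hS : MeasurableSet S := measurableSet_lt measurable_const measurable_subtype_coe
  have hcont : ∀ s : ℝ, 0 < s → Continuous fun y : Icc (0 : ℝ) 1 => (y : ℝ) ^ s := fun s hs =>
    (Real.continuous_rpow_const hs.le).comp continuous_subtype_val
  -- Mass at x = 0 would be mass escaped to t = ∞. Since x ^ s vanishes there, f ≤ P(x > 0), and
  -- f(0+) = 1 excludes such mass.
  have hle : ∀ s, 0 < s → f s ≤ P.real S := by
    intro s hs
    rw [← hρ s hs, ← integral_indicator_one hS]
    refine integral_mono ?_ ((integrable_const (1 : ℝ)).indicator hS) fun y => ?_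
    · refine Integrable.of_bound (hcont s hs).aestronglyMeasurable 1 (ae_of_all _ fun y => ?_)
      rw [Real.norm_of_nonneg (Real.rpow_nonneg y.2.1 s)]
      exact Real.rpow_le_one y.2.1 y.2.2 hs.le
    · by_cases hy : y ∈ S
      · simpa [indicator_of_mem hy] using Real.rpow_le_one y.2.1 y.2.2 hs.le
      · have : (y : ℝ) = 0 := le_antisymm (not_lt.1 hy) y.2.1
        simp [indicator_of_notMem hy, this, Real.zero_rpow hs.ne']
  have hS1 : 1 ≤ P.real S := _root_.le_of_tendsto hM (by
    filter_upwards [self_mem_nhdsWithin] with s hs using hle s hs)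
  have hae : ∀ᵐ y ∂P, y ∈ S := by
    have : P S = 1 := by
      refine le_antisymm prob_le_one ?_
      rw [← ENNReal.ofReal_one, ← ofReal_measureReal (measure_ne_top P S)]
      exact ENNReal.ofReal_le_ofReal hS1
    rwa [← prob_compl_eq_zero_iff hS] at this
  let T : Icc (0 : ℝ) 1 → ℝ := fun y => -Real.log y
  have hT : Measurable T := (Real.measurable_log.comp measurable_subtype_coe).neg
  refine ⟨P.map T, Measure.isProbabilityMeasure_map hT.aemeasurable, ?_, fun s hs => ?_⟩
  · rw [Measure.map_apply hT measurableSet_Iio]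
    convert! measure_empty (μ := P)
    ext y
    simp only [mem_preimage, mem_Iio, mem_empty_iff_false, iff_false, not_lt, T]
    exact neg_nonneg.2 (Real.log_nonpos y.2.1 y.2.2)
  · rw [measureLaplace, integral_map hT.aemeasurable (by fun_prop), ← hρ s hs]
    refine integral_congr_ae ?_
    filter_upwards [hae] with y hy
    rw [Real.rpow_def_of_pos hy]
    congr 1
    simp only [T]
    ring

/-- The Hausdorff–Bernstein–Widder theorem for functions with a finite limit at `0`. -/
theorem exists_measure (hf : IsCompletelyMonotone f) {M : ℝ}
    (hM : Tendsto f (𝓝[>] 0) (𝓝 M)) :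
    ∃ μ : Measure ℝ, IsFiniteMeasure μ ∧ μ (Iio 0) = 0 ∧ μ univ = ENNReal.ofReal M ∧
      ∀ s, 0 < s → measureLaplace μ s = f s := by
  have hM0 : 0 ≤ M := ge_of_tendsto hM (by
    filter_upwards [self_mem_nhdsWithin] with s hs using hf.nonneg' hs)
  rcases hM0.eq_or_lt with h0 | hpos
  · refine ⟨0, inferInstance, by simp, by simp [← h0], fun s hs => ?_⟩
    have h1 := hf.le_of_tendsto hM hs
    have h2 := hf.nonneg' hs
    simp only [measureLaplace, integral_zero_measure]
    linarith
  · have hcm : IsCompletelyMonotone (fun s => M⁻¹ * f s) := by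
      refine ⟨contDiffOn_const.mul hf.contDiffOn, fun n x hx => ?_⟩
      rw [iteratedDeriv_const_mul_field]
      have := mul_nonneg (inv_nonneg.2 hM0) (hf.nonneg n x hx)
      linarith
    obtain ⟨μ, hμ, h1, h2⟩ := hcm.exists_probabilityMeasure (by
      simpa [inv_mul_cancel₀ hpos.ne'] using hM.const_mul M⁻¹)
    refine ⟨ENNReal.ofReal M • μ, μ.smul_finite ENNReal.ofReal_ne_top, by simp [h1], by simp,
      fun s hs => ?_⟩
    have := h2 s hs
    rw [measureLaplace] at this ⊢
    rw [integral_smul_measure, this, ENNReal.toReal_ofReal hM0, smul_eq_mul,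
      mul_inv_cancel_left₀ hpos.ne']

end IsCompletelyMonotone

theorem ae_nonneg_of_measure_Iio {μ : Measure ℝ} (h : μ (Iio 0) = 0) : ∀ᵐ t ∂μ, 0 ≤ t := by
  rw [ae_iff]
  simp only [not_le]
  exact h

/-! ### Uniqueness of the Laplace transform of finite measures -/

section LaplaceUniqueness

open ProbabilityTheory Complex

theorem mgf_neg_eq_measureLaplace {μ : Measure ℝ} (s : ℝ) :
    mgf (fun t => -t) μ s = measureLaplace μ s := by
  simp [mgf, measureLaplace]

variable {μ ν : Measure ℝ} [IsFiniteMeasure μ] [IsFiniteMeasure ν]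

theorem integrable_exp_neg_mul (hμ : μ (Iio 0) = 0) {s : ℝ} (hs : 0 ≤ s) :
    Integrable (fun t => Real.exp (-(s * t))) μ := by
  refine Integrable.of_bound (by fun_prop) 1 ?_
  filter_upwards [ae_nonneg_of_measure_Iio hμ] with t ht
  rw [Real.norm_of_nonneg (Real.exp_pos _).le]
  exact Real.exp_le_one_iff.2 (neg_nonpos.2 (mul_nonneg hs ht))

theorem Ioi_subset_interior_integrableExpSet (hμ : μ (Iio 0) = 0) :
    Ioi 0 ⊆ interior (integrableExpSet (fun t => -t) μ) := by
  refine interior_maximal (fun s hs => ?_) isOpen_Ioi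
  have := integrable_exp_neg_mul (s := s) hμ (le_of_lt hs)
  simpa [integrableExpSet] using this

/-- The characteristic function is the boundary value on the imaginary axis of the transform, which
is holomorphic in the right half-plane. -/
theorem tendsto_complexMGF_neg (hμ : μ (Iio 0) = 0) (y : ℝ) :
    Tendsto (fun ε : ℝ => complexMGF (fun t => -t) μ (ε - y * I)) (𝓝[>] 0) (𝓝 (charFun μ y)) := by
  rw [charFun_apply_real]
  unfold complexMGF
  refine tendsto_integral_filter_of_dominated_convergence (fun _ => 1) ?_ ?_
    (integrable_const _) ?_
  · exact Eventually.of_forall fun ε => by fun_prop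
  · filter_upwards [self_mem_nhdsWithin] with ε hε
    filter_upwards [ae_nonneg_of_measure_Iio hμ] with t ht
    rw [Complex.norm_exp]
    refine Real.exp_le_one_iff.2 ?_
    have : 0 ≤ ε * t := mul_nonneg (le_of_lt hε) ht
    simpa using this
  · refine ae_of_all _ fun t => ?_
    have : Continuous fun ε : ℝ => cexp ((ε - y * I) * ((-t : ℝ) : ℂ)) := by fun_prop
    have := (this.tendsto 0).mono_left (nhdsWithin_le_nhds (s := Ioi 0))
    convert! this using 3
    push_cast
    ring

/-- A finite measure on `[0, ∞)` is determined by its Laplace transform. -/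
theorem measure_ext_of_measureLaplace (hμ : μ (Iio 0) = 0) (hν : ν (Iio 0) = 0)
    (h : ∀ s, 0 < s → measureLaplace μ s = measureLaplace ν s) : μ = ν := by
  refine Measure.ext_of_charFun (funext fun y => ?_)
  have hU : IsPreconnected {z : ℂ | z.re ∈ Ioi (0 : ℝ)} :=
    ((convex_Ioi (0 : ℝ)).linear_preimage reLm).isPreconnected
  have hX : AnalyticOnNhd ℂ (complexMGF (fun t => -t) μ) {z : ℂ | z.re ∈ Ioi (0 : ℝ)} :=
    analyticOnNhd_complexMGF.mono fun z hz => Ioi_subset_interior_integrableExpSet hμ hz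
  have hY : AnalyticOnNhd ℂ (complexMGF (fun t => -t) ν) {z : ℂ | z.re ∈ Ioi (0 : ℝ)} :=
    analyticOnNhd_complexMGF.mono fun z hz => Ioi_subset_interior_integrableExpSet hν hz
  have heq : EqOn (complexMGF (fun t => -t) μ) (complexMGF (fun t => -t) ν)
      {z : ℂ | z.re ∈ Ioi (0 : ℝ)} := by
    -- Identity theorem: agreement at the real points 1 + 1/(n+1), accumulating at 1, spreads to the
    -- half-plane.
    refine hX.eqOn_of_preconnected_of_frequently_eq hY hU (z₀ := 1) (by simp) ?_
    rw [frequently_iff_seq_forall]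
    refine ⟨fun n => ((1 + 1 / ((n : ℝ) + 1) : ℝ) : ℂ), ?_, fun n => ?_⟩
    · rw [tendsto_nhdsWithin_iff]
      constructor
      · have : Tendsto (fun n : ℕ => 1 + 1 / ((n : ℝ) + 1)) atTop (𝓝 (1 + 0)) :=
          tendsto_one_div_add_atTop_nhds_zero_nat.const_add 1
        rw [add_zero] at this
        simpa [Function.comp_def] using (continuous_ofReal.tendsto (1 : ℝ)).comp this
      · refine Eventually.of_forall fun n => ?_
        have : (1 : ℝ) / ((n : ℝ) + 1) ≠ 0 := by positivity
        simp only [mem_compl_iff, mem_singleton_iff]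
        intro h
        have := congrArg re h
        rw [ofReal_re, one_re] at this
        linarith [show (0 : ℝ) < 1 / ((n : ℝ) + 1) by positivity]
    · rw [complexMGF_ofReal, complexMGF_ofReal, mgf_neg_eq_measureLaplace,
        mgf_neg_eq_measureLaplace, h _ (by positivity)]
  refine tendsto_nhds_unique (tendsto_complexMGF_neg hμ y)
    ((tendsto_complexMGF_neg hν y).congr' ?_)
  filter_upwards [self_mem_nhdsWithin] with ε hε
  exact (heq (by simpa using hε)).symm

end LaplaceUniqueness

/-! ### Composition of completely monotone and Bernstein functions -/

section Composition

variable {F g : ℝ → ℝ}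

theorem IsCompletelyMonotone.neg_deriv (hF : IsCompletelyMonotone F) :
    IsCompletelyMonotone (fun x => -deriv F x) := by
  refine ⟨(hF.contDiffOn.deriv_of_isOpen isOpen_Ioi (m := ∞) (by simp)).neg, fun n x hx => ?_⟩
  have := hF.nonneg (n + 1) x hx
  rw [iteratedDeriv_succ'] at this
  rw [iteratedDeriv_fun_neg, pow_succ] at *
  linarith

theorem IsBernsteinFunction.isCompletelyMonotone_deriv (hg : IsBernsteinFunction g) :
    IsCompletelyMonotone (deriv g) := by
  refine ⟨hg.1.deriv_of_isOpen isOpen_Ioi (m := ∞) (by simp), fun n x hx => ?_⟩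
  have := hg.2.2 n x hx
  rwa [iteratedDeriv_succ'] at this

/-- The composition of a completely monotone function with a positive Bernstein function is
completely monotone. -/
theorem IsCompletelyMonotone.comp_bernstein (hF : IsCompletelyMonotone F)
    (hg : IsBernsteinFunction g) (hpos : ∀ x, 0 < x → 0 < g x) :
    IsCompletelyMonotone (fun x => F (g x)) := by
  have hcd : ∀ {F : ℝ → ℝ}, IsCompletelyMonotone F → ContDiffOn ℝ ∞ (fun x => F (g x)) (Ioi 0) :=
    fun hF => hF.contDiffOn.comp hg.1 fun x hx => hpos x hx
  refine ⟨hcd hF, fun n => ?_⟩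
  induction n using Nat.strong_induction_on generalizing F with
  | _ n ih =>
  intro x hx
  rcases n with _ | n
  · simpa using hF.nonneg' (hpos x hx)
  -- Since -F' is again completely monotone, F ∘ g has derivative minus the product of (-F') ∘ g and
  -- g'. Leibniz then only involves lower derivatives of (-F') ∘ g, which is why the induction is
  -- over all `F` at once.
  · have hder : ∀ y, 0 < y → deriv (fun x => F (g x)) y
        = -((fun x => -deriv F (g x)) * deriv g) y := by
      intro y hy
      have h1 := hF.contDiffOn.hasDerivAt_iteratedDeriv 0 (hpos y hy)
      have h2 := hg.1.hasDerivAt_iteratedDeriv 0 hy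
      rw [iteratedDeriv_zero, zero_add, iteratedDeriv_one] at h1 h2
      have h3 := h1.comp y h2
      rw [Function.comp_def] at h3
      rw [h3.deriv]
      simp
    have hev : deriv (fun x => F (g x)) =ᶠ[𝓝 x]
        fun y => -((fun x => -deriv F (g x)) * deriv g) y := by
      filter_upwards [Ioi_mem_nhds hx] with y hy using hder y hy
    have hc1 : ContDiffAt ℝ n (fun x => -deriv F (g x)) x :=
      ((hcd hF.neg_deriv).contDiffAt (Ioi_mem_nhds hx)).of_le (mod_cast le_top)
    have hc2 : ContDiffAt ℝ n (deriv g) x :=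
      (hg.isCompletelyMonotone_deriv.contDiffOn.contDiffAt (Ioi_mem_nhds hx)).of_le (mod_cast le_top)
    rw [iteratedDeriv_succ', hev.iteratedDeriv_eq n, iteratedDeriv_fun_neg,
      iteratedDeriv_mul hc1 hc2, mul_neg, pow_succ, mul_neg_one, neg_mul, neg_neg, Finset.mul_sum]
    refine Finset.sum_nonneg fun k hk => ?_
    have hkn : k ≤ n := Nat.lt_succ_iff.1 (Finset.mem_range.1 hk)
    have e1 := ih k (Nat.lt_succ_of_le hkn) hF.neg_deriv x hx
    have e2 := hg.isCompletelyMonotone_deriv.nonneg (n - k) x hx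
    have e3 : (-1 : ℝ) ^ n = (-1) ^ k * (-1) ^ (n - k) := by rw [← pow_add, Nat.add_sub_cancel' hkn]
    rw [e3]
    have := mul_nonneg (mul_nonneg (Nat.cast_nonneg (n.choose k)) e1) e2
    convert! this using 1
    ring

end Composition

/-! ### Subordination and convolution of measures on the half-line -/

section Subordination

open ProbabilityTheory

theorem isCompletelyMonotone_measureLaplace {θ : Measure ℝ} [IsFiniteMeasure θ]
    (hθ : θ (Iio 0) = 0) : IsCompletelyMonotone (measureLaplace θ) := by
  have hsub := Ioi_subset_interior_integrableExpSet hθ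
  have heq : measureLaplace θ = mgf (fun t => -t) θ :=
    funext fun s => (mgf_neg_eq_measureLaplace s).symm
  rw [heq]
  refine ⟨fun x hx => (analyticAt_mgf (hsub hx)).contDiffAt.contDiffWithinAt, fun n x hx => ?_⟩
  rw [iteratedDeriv_mgf (hsub hx), ← integral_const_mul]
  refine integral_nonneg_of_ae ?_
  filter_upwards [ae_nonneg_of_measure_Iio hθ] with t ht
  have : (-1 : ℝ) ^ n * ((-t) ^ n * Real.exp (x * -t)) = t ^ n * Real.exp (x * -t) := by
    rw [← mul_assoc, ← mul_pow]; simp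
  simp only [Pi.zero_apply, this]
  positivity

theorem tendsto_measureLaplace_zero {θ : Measure ℝ} [IsFiniteMeasure θ] (hθ : θ (Iio 0) = 0) :
    Tendsto (measureLaplace θ) (𝓝[>] 0) (𝓝 (θ.real univ)) := by
  have : θ.real univ = ∫ t, Real.exp (-(0 * t)) ∂θ := by simp
  rw [this]
  refine tendsto_integral_filter_of_dominated_convergence (fun _ => 1) ?_ ?_
    (integrable_const _) ?_
  · exact Eventually.of_forall fun ε => by fun_prop
  · filter_upwards [self_mem_nhdsWithin] with s hs
    filter_upwards [ae_nonneg_of_measure_Iio hθ] with t ht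
    rw [Real.norm_of_nonneg (Real.exp_pos _).le]
    exact Real.exp_le_one_iff.2 (neg_nonpos.2 (mul_nonneg (le_of_lt hs) ht))
  · refine ae_of_all _ fun t => ?_
    have : Continuous fun s : ℝ => Real.exp (-(s * t)) := by fun_prop
    exact (this.tendsto 0).mono_left nhdsWithin_le_nhds

/-- Subordination of a finite measure `θ` by the Bernstein function `g`. -/
theorem exists_subordinate {g : ℝ → ℝ} (hg : IsBernsteinFunction g)
    (hpos : ∀ x, 0 < x → 0 < g x) (h0 : Tendsto g (𝓝[>] 0) (𝓝 0))
    (θ : Measure ℝ) [IsFiniteMeasure θ] (hθ : θ (Iio 0) = 0) :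
    ∃ μ : Measure ℝ, IsFiniteMeasure μ ∧ μ (Iio 0) = 0 ∧ μ univ = θ univ ∧
      ∀ s, 0 < s → measureLaplace μ s = measureLaplace θ (g s) := by
  have hcm := (isCompletelyMonotone_measureLaplace hθ).comp_bernstein hg hpos
  have ht : Tendsto (fun x => measureLaplace θ (g x)) (𝓝[>] 0) (𝓝 (θ.real univ)) := by
    refine (tendsto_measureLaplace_zero hθ).comp (tendsto_nhdsWithin_iff.2 ⟨h0, ?_⟩)
    filter_upwards [self_mem_nhdsWithin] with x hx using hpos x hx
  obtain ⟨μ, h1, h2, h3, h4⟩ := hcm.exists_measure ht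
  exact ⟨μ, h1, h2, by rw [h3, ofReal_measureReal], h4⟩

theorem conv_Iio_zero {μ ν : Measure ℝ} [IsFiniteMeasure μ] [IsFiniteMeasure ν]
    (hμ : μ (Iio 0) = 0) (hν : ν (Iio 0) = 0) : (μ ∗ ν) (Iio 0) = 0 := by
  rw [← lintegral_indicator_one measurableSet_Iio,
    Measure.lintegral_conv (measurable_one.indicator measurableSet_Iio)]
  refine lintegral_eq_zero_of_ae_eq_zero ?_
  filter_upwards [ae_nonneg_of_measure_Iio hμ] with x hx
  refine lintegral_eq_zero_of_ae_eq_zero ?_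
  filter_upwards [ae_nonneg_of_measure_Iio hν] with y hy
  rw [indicator_of_notMem (by simp only [mem_Iio, not_lt]; linarith)]
  rfl

theorem measureLaplace_conv {μ ν : Measure ℝ} [IsFiniteMeasure μ] [IsFiniteMeasure ν]
    (hμ : μ (Iio 0) = 0) (hν : ν (Iio 0) = 0) {s : ℝ} (hs : 0 ≤ s) :
    measureLaplace (μ ∗ ν) s = measureLaplace μ s * measureLaplace ν s := by
  unfold measureLaplace
  rw [integral_conv (integrable_exp_neg_mul (conv_Iio_zero hμ hν) hs)]
  simp_rw [mul_add, neg_add, Real.exp_add, integral_const_mul, integral_mul_const]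

end Subordination

/-! ### Bounding characteristic functions by Laplace transforms -/

section CharFunBound

theorem half_le_one_sub_exp_neg {v : ℝ} (hv : 1 ≤ v) : 1 / 2 ≤ 1 - Real.exp (-v) := by
  have h1 : Real.exp (-v) ≤ Real.exp (-1) := Real.exp_le_exp.2 (by linarith)
  have h2 : Real.exp (-1) ≤ 1 / 2 := by
    rw [Real.exp_neg, inv_le_comm₀ (Real.exp_pos _) (by norm_num)]
    linarith [Real.add_one_le_exp (1 : ℝ)]
  linarith

theorem le_two_mul_one_sub_exp_neg {v : ℝ} (h0 : 0 ≤ v) (h1 : v ≤ 1) :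
    v ≤ 2 * (1 - Real.exp (-v)) := by
  have h := Real.add_one_le_exp v
  have h2 : Real.exp (-v) ≤ (v + 1)⁻¹ := by
    rw [Real.exp_neg]
    exact inv_anti₀ (by linarith) h
  have h3 : (v + 1)⁻¹ ≤ 1 - v / 2 := by
    rw [inv_le_iff_one_le_mul₀ (by linarith)]
    nlinarith
  linarith

theorem one_sub_exp_neg_nonneg {v : ℝ} (hv : 0 ≤ v) : 0 ≤ 1 - Real.exp (-v) := by
  linarith [Real.exp_le_one_iff.2 (neg_nonpos.2 hv)]

theorem one_sub_cos_le {v : ℝ} (hv : 0 ≤ v) : 1 - Real.cos v ≤ 4 * (1 - Real.exp (-v)) := by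
  rcases le_total v 1 with h | h
  · have := Real.one_sub_sq_div_two_le_cos (x := v)
    have := le_two_mul_one_sub_exp_neg hv h
    nlinarith
  · linarith [half_le_one_sub_exp_neg h, Real.neg_one_le_cos v]

theorem abs_sin_le {v : ℝ} (hv : 0 ≤ v) : |Real.sin v| ≤ 4 * (1 - Real.exp (-v)) := by
  rcases le_total v 1 with h | h
  · have h1 : |Real.sin v| ≤ |v| := Real.abs_sin_le_abs
    rw [abs_of_nonneg hv] at h1
    linarith [le_two_mul_one_sub_exp_neg hv h]
  · linarith [half_le_one_sub_exp_neg h, Real.abs_sin_le_one v]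

/-- The lower bound is a combination of functions 1 - e^{-sx}, so that it integrates to Laplace
transforms. If yx ≥ 1 the second term makes the bracket non-positive; if wx ≤ 1 the third does. In
between the bracket is at most 1, and 1 - cos(yx) ≥ (2/π²)(yx)² ≥ (1/5)(y/w)². -/
theorem le_one_sub_cos {x y z w : ℝ} (hx : 0 ≤ x) (hy : 0 < y) (hz : 0 < z) (hw : 0 < w) :
    1 / 5 * (y / w) ^ 2 * ((1 - Real.exp (-(z * x))) - 2 * (1 - Real.exp (-(y * x)))
      - 2 * (z / w) * (1 - Real.exp (-(w * x)))) ≤ 1 - Real.cos (y * x) := by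
  have hcos : 0 ≤ 1 - Real.cos (y * x) := by linarith [Real.cos_le_one (y * x)]
  have ey := one_sub_exp_neg_nonneg (mul_nonneg hy.le hx)
  have ew := mul_nonneg (div_pos hz hw).le (one_sub_exp_neg_nonneg (mul_nonneg hw.le hx))
  have hc : 0 ≤ 1 / 5 * (y / w) ^ 2 := by positivity
  rcases le_or_gt 1 (y * x) with h1 | h1
  · refine le_trans (mul_nonpos_of_nonneg_of_nonpos hc ?_) hcos
    linarith [half_le_one_sub_exp_neg h1, Real.exp_pos (-(z * x))]
  rcases le_or_gt (w * x) 1 with h2 | h2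
  · refine le_trans (mul_nonpos_of_nonneg_of_nonpos hc ?_) hcos
    have h3 := mul_le_mul_of_nonneg_left (le_two_mul_one_sub_exp_neg (mul_nonneg hw.le hx) h2)
      (div_pos hz hw).le
    have h4 : z / w * (w * x) = z * x := by field_simp
    linarith [Real.add_one_le_exp (-(z * x))]
  · have h3 : (1 - Real.exp (-(z * x))) - 2 * (1 - Real.exp (-(y * x)))
      - 2 * (z / w) * (1 - Real.exp (-(w * x))) ≤ 1 := by linarith [Real.exp_pos (-(z * x))]
    refine (mul_le_of_le_one_right hc h3).trans ?_
    have h4 : y / w ≤ y * x := by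
      rw [div_le_iff₀ hw]
      nlinarith
    have h5 : (y / w) ^ 2 ≤ (y * x) ^ 2 := pow_le_pow_left₀ (by positivity) h4 2
    have hyx : 0 ≤ y * x := by positivity
    have h6 := Real.cos_le_one_sub_mul_cos_sq (x := y * x) (by
      rw [abs_of_nonneg hyx]; linarith [Real.pi_gt_three])
    have h7 : 1 / 5 ≤ 2 / Real.pi ^ 2 := by
      rw [div_le_div_iff₀ (by norm_num) (by positivity)]
      nlinarith [Real.pi_lt_d2, Real.pi_gt_three]
    nlinarith [mul_le_mul_of_nonneg_right h7 (sq_nonneg (y * x))]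

variable {q : Measure ℝ} [IsProbabilityMeasure q]

theorem integral_one_sub_exp (hq : q (Iio 0) = 0) {s : ℝ} (hs : 0 ≤ s) :
    ∫ x, (1 - Real.exp (-(s * x))) ∂q = 1 - measureLaplace q s := by
  rw [integral_sub (integrable_const _) (integrable_exp_neg_mul hq hs)]
  simp [measureLaplace]

theorem integrable_one_sub_exp (hq : q (Iio 0) = 0) {s : ℝ} (hs : 0 ≤ s) :
    Integrable (fun x => 1 - Real.exp (-(s * x))) q :=
  (integrable_const _).sub (integrable_exp_neg_mul hq hs)

/-- With charFun = (1 - A) + iB, the squared norm is 1 - 2A + A² + B². The linear term is bounded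
through `le_one_sub_cos`; A and |B| are at most 4(1 - L(y)), L being the Laplace transform of `q`,
whence the error 32(1 - L(y))². Being quadratic, it disappears under infinite divisibility. -/
theorem norm_sq_charFun_le (hq : q (Iio 0) = 0) {y z w : ℝ} (hy : 0 < y) (hz : 0 < z)
    (hw : 0 < w) :
    ‖charFun q y‖ ^ 2 ≤ Real.exp (-(2 / 5 * (y / w) ^ 2 * ((1 - measureLaplace q z)
      - 2 * (1 - measureLaplace q y) - 2 * (z / w) * (1 - measureLaplace q w)))
      + 32 * (1 - measureLaplace q y) ^ 2) := by
  have hic : Integrable (fun x => Real.cos (y * x)) q :=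
    Integrable.of_bound (by fun_prop) 1 (ae_of_all _ fun x => Real.abs_cos_le_one _)
  have his : Integrable (fun x => Real.sin (y * x)) q :=
    Integrable.of_bound (by fun_prop) 1 (ae_of_all _ fun x => Real.abs_sin_le_one _)
  set A := ∫ x, (1 - Real.cos (y * x)) ∂q with hA
  set B := ∫ x, Real.sin (y * x) ∂q with hB
  have hA' : A = 1 - ∫ x, Real.cos (y * x) ∂q := by
    rw [hA, integral_sub (integrable_const _) hic]; simp
  have hch : charFun q y = ((1 - A : ℝ) : ℂ) + (B : ℝ) * Complex.I := by
    rw [charFun_apply_real]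
    have : ∀ x : ℝ, Complex.exp (y * x * Complex.I)
        = ((Real.cos (y * x) : ℝ) : ℂ) + ((Real.sin (y * x) : ℝ) : ℂ) * Complex.I := fun x => by
      rw [Complex.exp_mul_I]; push_cast; rfl
    simp_rw [this]
    rw [integral_add hic.ofReal (his.ofReal.mul_const _), integral_mul_const,
      integral_complex_ofReal, integral_complex_ofReal, hA']
    simp [hB]
  have hnorm : ‖charFun q y‖ ^ 2 = (1 - A) ^ 2 + B ^ 2 := by
    rw [hch, Complex.sq_norm, Complex.normSq_add_mul_I]
  have hae := ae_nonneg_of_measure_Iio hq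
  have hL := integral_one_sub_exp hq hy.le
  have hA0 : 0 ≤ A := integral_nonneg fun x => by simp only [Pi.zero_apply]; linarith [Real.cos_le_one (y * x)]
  have hA1 : A ≤ 4 * (1 - measureLaplace q y) := by
    rw [← hL, ← integral_const_mul]
    refine integral_mono_ae ((integrable_const _).sub hic)
      ((integrable_one_sub_exp hq hy.le).const_mul 4) ?_
    filter_upwards [hae] with x hx using one_sub_cos_le (mul_nonneg hy.le hx)
  have hB1 : |B| ≤ 4 * (1 - measureLaplace q y) := by
    rw [← hL, ← integral_const_mul]
    refine (abs_integral_le_integral_abs).trans (integral_mono_ae his.abs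
      ((integrable_one_sub_exp hq hy.le).const_mul 4) ?_)
    filter_upwards [hae] with x hx using abs_sin_le (mul_nonneg hy.le hx)
  have hA2 : 1 / 5 * (y / w) ^ 2 * ((1 - measureLaplace q z)
      - 2 * (1 - measureLaplace q y) - 2 * (z / w) * (1 - measureLaplace q w)) ≤ A := by
    have iz := integrable_one_sub_exp hq hz.le
    have iy := (integrable_one_sub_exp hq hy.le).const_mul 2
    have iw := (integrable_one_sub_exp hq hw.le).const_mul (2 * (z / w))
    have izy : Integrable (fun x => 1 - Real.exp (-(z * x)) - 2 * (1 - Real.exp (-(y * x)))) q :=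
      iz.sub iy
    rw [← integral_one_sub_exp hq hz.le, ← integral_one_sub_exp hq hy.le,
      ← integral_one_sub_exp hq hw.le, ← integral_const_mul, ← integral_const_mul,
      ← integral_sub iz iy, ← integral_sub izy iw, ← integral_const_mul]
    refine integral_mono_ae ((izy.sub iw).const_mul _) ((integrable_const _).sub hic) ?_
    filter_upwards [hae] with x hx using le_one_sub_cos hx hy hz hw
  have hAsq : A ^ 2 ≤ 16 * (1 - measureLaplace q y) ^ 2 := by
    have := pow_le_pow_left₀ hA0 hA1 2
    linarith
  have hBsq : B ^ 2 ≤ 16 * (1 - measureLaplace q y) ^ 2 := by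
    have := pow_le_pow_left₀ (abs_nonneg B) hB1 2
    rw [sq_abs] at this
    linarith
  rw [hnorm]
  refine le_trans ?_ (Real.add_one_le_exp _)
  linarith

end CharFunBound

/-! ### Subordinator laws and their infinite divisibility -/

section Semigroup

/-- A family of probability measures on `[0, ∞)` with Laplace transforms `exp (-t g)`. -/
structure IsSubordinator (g : ℝ → ℝ) (P : ℝ → Measure ℝ) : Prop where
  isProbabilityMeasure : ∀ t, 0 < t → IsProbabilityMeasure (P t)
  Iio_zero : ∀ t, 0 < t → P t (Iio 0) = 0
  laplace : ∀ t, 0 < t → ∀ s, 0 < s → measureLaplace (P t) s = Real.exp (-(t * g s))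

theorem IsBernsteinFunction.exists_isSubordinator {g : ℝ → ℝ} (hg : IsBernsteinFunction g)
    (hpos : ∀ x, 0 < x → 0 < g x) (h0 : Tendsto g (𝓝[>] 0) (𝓝 0)) :
    ∃ P, IsSubordinator g P := by
  have : ∀ t, ∃ μ : Measure ℝ, 0 < t → IsProbabilityMeasure μ ∧ μ (Iio 0) = 0 ∧
      ∀ s, 0 < s → measureLaplace μ s = Real.exp (-(t * g s)) := by
    intro t
    by_cases ht : 0 < t
    · obtain ⟨μ, -, h2, h3, h4⟩ := exists_subordinate hg hpos h0 (Measure.dirac t)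
        (by simp [ht.le])
      refine ⟨μ, fun _ => ⟨⟨by simpa using h3⟩, h2, fun s hs => ?_⟩⟩
      rw [h4 s hs, measureLaplace, integral_dirac, mul_comm]
    · exact ⟨0, fun h => absurd h ht⟩
  choose P hP using this
  exact ⟨P, fun t ht => (hP t ht).1, fun t ht => (hP t ht).2.1, fun t ht => (hP t ht).2.2⟩

namespace IsSubordinator

variable {g : ℝ → ℝ} {P : ℝ → Measure ℝ}

theorem conv_self (hP : IsSubordinator g P) {t : ℝ} (ht : 0 < t) :
    P t ∗ P t = P (2 * t) := by
  have := hP.isProbabilityMeasure t ht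
  have := hP.isProbabilityMeasure (2 * t) (by positivity)
  refine measure_ext_of_measureLaplace
    (conv_Iio_zero (hP.Iio_zero t ht) (hP.Iio_zero t ht)) (hP.Iio_zero _ (by positivity))
    fun s hs => ?_
  rw [measureLaplace_conv (hP.Iio_zero t ht) (hP.Iio_zero t ht) hs.le, hP.laplace t ht s hs,
    hP.laplace _ (by positivity) s hs, ← Real.exp_add]
  ring_nf

theorem charFun_eq_pow (hP : IsSubordinator g P) (j : ℕ) {t : ℝ} (ht : 0 < t) (y : ℝ) :
    charFun (P t) y = charFun (P (t / 2 ^ j)) y ^ 2 ^ j := by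
  induction j with
  | zero => simp
  | succ j ih =>
    have hpos : 0 < t / 2 ^ (j + 1) := by positivity
    have := hP.isProbabilityMeasure _ hpos
    rw [ih, show t / 2 ^ j = 2 * (t / 2 ^ (j + 1)) by rw [pow_succ]; field_simp,
      ← hP.conv_self hpos, charFun_conv, ← pow_two, ← pow_mul, pow_succ' (2 : ℕ) j]

theorem tendsto_two_pow_mul_one_sub_exp (c : ℝ) :
    Tendsto (fun j : ℕ => (2 : ℝ) ^ j * (1 - Real.exp (-(c / 2 ^ j)))) atTop (𝓝 c) := by
  have h1 : HasDerivAt (fun x : ℝ => 1 - Real.exp (-(c * x))) c 0 := by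
    have := ((((hasDerivAt_id (0 : ℝ)).const_mul c).neg).exp).const_sub 1
    simpa using this
  rw [hasDerivAt_iff_tendsto_slope_zero] at h1
  have h2 : Tendsto (fun j : ℕ => ((2 : ℝ) ^ j)⁻¹) atTop (𝓝[≠] 0) := by
    rw [tendsto_nhdsWithin_iff]
    refine ⟨(tendsto_pow_atTop_atTop_of_one_lt one_lt_two).inv_tendsto_atTop,
      Eventually.of_forall fun j => ?_⟩
    simp
  refine (h1.comp h2).congr fun j => ?_
  simp [div_eq_mul_inv]

/-- Apply the one-measure bound to P_{t/2^j} and raise it to the power 2^j. The linear terms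
converge to multiples of t g, while the quadratic error is O(2^{-j}). -/
theorem norm_sq_charFun_le (hP : IsSubordinator g P) {t : ℝ} (ht : 0 < t) {y z w : ℝ}
    (hy : 0 < y) (hz : 0 < z) (hw : 0 < w) :
    ‖charFun (P t) y‖ ^ 2 ≤
      Real.exp (-(2 / 5 * (y / w) ^ 2 * (t * g z - 2 * (t * g y) - 2 * (z / w) * (t * g w)))) := by
  let N : ℝ → ℕ → ℝ := fun s j => (2 : ℝ) ^ j * (1 - Real.exp (-(t * g s / 2 ^ j)))
  have hN : ∀ s, Tendsto (N s) atTop (𝓝 (t * g s)) := fun s => tendsto_two_pow_mul_one_sub_exp _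
  have hlim : Tendsto (fun j => Real.exp (-(2 / 5 * (y / w) ^ 2 *
      (N z j - 2 * N y j - 2 * (z / w) * N w j)) + 32 * (N y j) ^ 2 * ((2 : ℝ) ^ j)⁻¹)) atTop
      (𝓝 (Real.exp (-(2 / 5 * (y / w) ^ 2 * (t * g z - 2 * (t * g y) - 2 * (z / w) * (t * g w)))
        + 32 * (t * g y) ^ 2 * 0))) := by
    refine (Real.continuous_exp.tendsto _).comp ?_
    refine Tendsto.add ?_ ?_
    · exact ((((hN z).sub ((hN y).const_mul 2)).sub ((hN w).const_mul _)).const_mul _).neg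
    · exact (((hN y).pow 2).const_mul 32).mul
        (tendsto_pow_atTop_atTop_of_one_lt one_lt_two).inv_tendsto_atTop
  rw [mul_zero, add_zero] at hlim
  refine ge_of_tendsto' hlim fun j => ?_
  have hpos : 0 < t / 2 ^ j := by positivity
  have := hP.isProbabilityMeasure _ hpos
  have h1 := _root_.norm_sq_charFun_le (hP.Iio_zero _ hpos) hy hz hw
  rw [hP.laplace _ hpos z hz, hP.laplace _ hpos y hy, hP.laplace _ hpos w hw] at h1
  rw [hP.charFun_eq_pow j ht, norm_pow, ← pow_mul, mul_comm (2 ^ j) 2, pow_mul]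
  refine (pow_le_pow_left₀ (by positivity) h1 _).trans_eq ?_
  rw [← Real.exp_nat_mul]
  congr 1
  have h2 : (2 : ℝ) ^ j ≠ 0 := by positivity
  simp only [N, div_mul_eq_mul_div]
  push_cast
  field_simp

end IsSubordinator

end Semigroup

/-! ### Absolute continuity from an integrable characteristic function -/

section Density

open ProbabilityTheory

theorem exp_neg_sq_eq_integral_gaussianReal {h : ℝ} (hh : 0 < h) (u : ℝ) :
    ((Real.exp (-(u / h) ^ 2) : ℝ) : ℂ)
      = ∫ y, Complex.exp (u * y * Complex.I) ∂(gaussianReal 0 (2 / h ^ 2).toNNReal) := by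
  rw [← charFun_apply_real, charFun_gaussianReal]
  rw [Real.coe_toNNReal _ (by positivity)]
  push_cast
  congr 1
  have : (h : ℂ) ≠ 0 := by exact_mod_cast hh.ne'
  field_simp
  ring

/-- A Gaussian bump of width `h` dominates the ball's indicator up to the factor e. Fubini moves its
integral to the Fourier side, where the Gaussian has variance 2/h² and hence density at most h/(2√π)
≤ h. -/
theorem measureReal_closedBall_le {P : Measure ℝ} [IsProbabilityMeasure P]
    (hP : Integrable (charFun P)) (a : ℝ) {h : ℝ} (hh : 0 < h) :
    P.real (Metric.closedBall a h) ≤ Real.exp 1 * (∫ y, ‖charFun P y‖) * h := by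
  set v : NNReal := (2 / h ^ 2).toNNReal with hv
  have hvc : (v : ℝ) = 2 / h ^ 2 := Real.coe_toNNReal _ (by positivity)
  have hv0 : v ≠ 0 := by
    rw [ne_eq, ← NNReal.coe_inj, hvc, NNReal.coe_zero]
    positivity
  have hint : Integrable (fun x => Real.exp (-((x - a) / h) ^ 2)) P := by
    refine Integrable.of_bound (by fun_prop) 1 (ae_of_all _ fun x => ?_)
    rw [Real.norm_of_nonneg (Real.exp_pos _).le, Real.exp_le_one_iff]
    nlinarith [sq_nonneg ((x - a) / h)]
  have h1 : P.real (Metric.closedBall a h)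
      ≤ Real.exp 1 * ∫ x, Real.exp (-((x - a) / h) ^ 2) ∂P := by
    rw [← integral_const_mul, ← integral_indicator_one Metric.isClosed_closedBall.measurableSet]
    refine integral_mono ((integrable_const (1 : ℝ)).indicator
      Metric.isClosed_closedBall.measurableSet) (hint.const_mul _) fun x => ?_
    by_cases hx : x ∈ Metric.closedBall a h
    · simp only [indicator_of_mem hx, Pi.one_apply]
      rw [← Real.exp_add, Real.one_le_exp_iff]
      rw [Metric.mem_closedBall, Real.dist_eq] at hx
      have : ((x - a) / h) ^ 2 ≤ 1 := by
        rw [sq_le_one_iff_abs_le_one, abs_div, abs_of_pos hh, div_le_one hh]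
        exact hx
      linarith
    · simp only [indicator_of_notMem hx]
      positivity
  have h2 : ((∫ x, Real.exp (-((x - a) / h) ^ 2) ∂P : ℝ) : ℂ)
      = ∫ y, Complex.exp (-(a * y * Complex.I)) * charFun P y ∂(gaussianReal 0 v) := by
    rw [← integral_complex_ofReal]
    simp_rw [exp_neg_sq_eq_integral_gaussianReal hh]
    rw [integral_integral_swap]
    · refine integral_congr_ae (ae_of_all _ fun y => ?_)
      simp only [charFun_apply_real]
      rw [← integral_const_mul]
      refine integral_congr_ae (ae_of_all _ fun x => ?_)
      simp only
      rw [← Complex.exp_add]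
      congr 1
      push_cast
      ring
    · refine Integrable.of_bound (by fun_prop) 1 (ae_of_all _ fun p => ?_)
      simp only [Function.uncurry]
      rw [← Complex.ofReal_mul, Complex.norm_exp_ofReal_mul_I]
  have h3 : ∫ x, Real.exp (-((x - a) / h) ^ 2) ∂P ≤ (∫ y, ‖charFun P y‖) * h := by
    have h0 : 0 ≤ ∫ x, Real.exp (-((x - a) / h) ^ 2) ∂P :=
      integral_nonneg fun x => (Real.exp_pos _).le
    have hn : ∫ x, Real.exp (-((x - a) / h) ^ 2) ∂P
        ≤ ∫ y, ‖charFun P y‖ ∂(gaussianReal 0 v) := by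
      rw [← Real.norm_of_nonneg h0, ← Complex.norm_real, h2]
      refine (norm_integral_le_integral_norm _).trans_eq (integral_congr_ae (ae_of_all _ fun y => ?_))
      simp only
      rw [norm_mul, ← Complex.ofReal_mul, ← neg_mul, ← Complex.ofReal_neg,
        Complex.norm_exp_ofReal_mul_I, one_mul]
    refine hn.trans ?_
    rw [integral_gaussianReal_eq_integral_smul hv0, ← integral_mul_const]
    have hpdf : ∀ y, gaussianPDFReal 0 v y ≤ h := fun y => by
      unfold gaussianPDFReal
      have e1 : Real.exp (-(y - 0) ^ 2 / (2 * v)) ≤ 1 := by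
        rw [Real.exp_le_one_iff]
        exact div_nonpos_of_nonpos_of_nonneg (by nlinarith [sq_nonneg (y - 0)]) (by positivity)
      have e2 : (√(2 * Real.pi * v))⁻¹ ≤ h := by
        rw [inv_le_comm₀ (by positivity) hh]
        refine Real.le_sqrt_of_sq_le ?_
        rw [hvc, inv_pow]
        rw [inv_le_iff_one_le_mul₀ (by positivity)]
        have : 2 * Real.pi * (2 / h ^ 2) * h ^ 2 = 4 * Real.pi := by field_simp; ring
        rw [this]
        linarith [Real.pi_gt_three]
      calc _ ≤ (√(2 * Real.pi * v))⁻¹ * 1 := by gcongr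
        _ ≤ h := by rwa [mul_one]
    refine integral_mono_of_nonneg (ae_of_all _ fun y => ?_) (hP.norm.mul_const h)
      (ae_of_all _ fun y => ?_)
    · exact smul_nonneg (gaussianPDFReal_nonneg 0 v y) (norm_nonneg _)
    · simp only [smul_eq_mul]
      rw [mul_comm]
      exact mul_le_mul_of_nonneg_left (hpdf y) (norm_nonneg _)
  rw [mul_assoc]
  exact h1.trans (mul_le_mul_of_nonneg_left h3 (Real.exp_pos 1).le)

/-- A measure with uniformly bounded mean density on balls is absolutely continuous. -/
theorem absolutelyContinuous_of_closedBall_le {P : Measure ℝ} [IsFiniteMeasure P] {K : ℝ}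
    (hK : 0 < K) (h : ∀ a r, 0 < r → P.real (Metric.closedBall a r) ≤ K * r) : P ≪ volume := by
  -- Radius 0 is needed for covering sets of zero diameter in the comparison with one-dimensional
  -- Hausdorff measure.
  have h0 : ∀ a r, 0 ≤ r → P (Metric.closedBall a r) ≤ ENNReal.ofReal (K * r) := by
    intro a r hr
    have hlim : Tendsto (fun ε : ℝ => ENNReal.ofReal (K * (r + ε))) (𝓝[>] 0)
        (𝓝 (ENNReal.ofReal (K * r))) := by
      have : Continuous fun ε : ℝ => ENNReal.ofReal (K * (r + ε)) :=
        ENNReal.continuous_ofReal.comp (by fun_prop)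
      simpa using (this.tendsto 0).mono_left (nhdsWithin_le_nhds (s := Ioi 0))
    refine ge_of_tendsto hlim ?_
    filter_upwards [self_mem_nhdsWithin] with ε hε
    rw [mem_Ioi] at hε
    refine (measure_mono
      (Metric.closedBall_subset_closedBall (le_add_of_nonneg_right hε.le))).trans ?_
    rw [← ofReal_measureReal]
    exact ENNReal.ofReal_le_ofReal (h a (r + ε) (by linarith))
  have hle : (ENNReal.ofReal K)⁻¹ • P ≤ volume := by
    rw [← hausdorffMeasure_real]
    refine Measure.le_hausdorffMeasure 1 _ 1 one_pos fun s hs => ?_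
    rcases s.eq_empty_or_nonempty with rfl | ⟨x, hx⟩
    · simp
    have hfin : Metric.ediam s ≠ ⊤ := (hs.trans_lt ENNReal.one_lt_top).ne
    have hsub : s ⊆ Metric.closedBall x (Metric.ediam s).toReal := fun y hy => by
      rw [Metric.mem_closedBall, dist_edist]
      exact ENNReal.toReal_mono hfin (Metric.edist_le_ediam_of_mem hy hx)
    have h1 := (measure_mono hsub).trans (h0 x _ ENNReal.toReal_nonneg)
    rw [ENNReal.ofReal_mul hK.le, ENNReal.ofReal_toReal hfin] at h1
    rw [Measure.smul_apply, smul_eq_mul, ENNReal.rpow_one]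
    refine (mul_le_mul_right h1 _).trans_eq ?_
    rw [← mul_assoc, ENNReal.inv_mul_cancel (by simpa using hK) ENNReal.ofReal_ne_top, one_mul]
  refine Measure.AbsolutelyContinuous.mk fun s _ hs => ?_
  have := hle s
  rw [hs, Measure.smul_apply, smul_eq_mul, nonpos_iff_eq_zero, mul_eq_zero] at this
  exact this.resolve_left (by simp)

theorem absolutelyContinuous_of_integrable_charFun {P : Measure ℝ} [IsProbabilityMeasure P]
    (hP : Integrable (charFun P)) : P ≪ volume := by
  refine absolutelyContinuous_of_closedBall_le (K := Real.exp 1 * (∫ y, ‖charFun P y‖) + 1) ?_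
    fun a r hr => (measureReal_closedBall_le hP a hr).trans ?_
  · have := mul_nonneg (Real.exp_pos 1).le 
      (integral_nonneg (μ := volume) fun y => norm_nonneg (charFun P y))
    linarith
  · exact mul_le_mul_of_nonneg_right (by linarith) hr.le

end Density

/-! ### Decay of the characteristic function from the growth of g -/

section Growth

/-- `g` grows at infinity like `s ^ (β + o(1))`. -/
def HasGrowthIndex (g : ℝ → ℝ) (β : ℝ) : Prop :=
  ∀ η : ℝ, 0 < η → ∀ᶠ s in atTop, s ^ (β - η) ≤ g s ∧ g s ≤ s ^ (β + η)

/-- Take z = y^a and w = y^{a²} with a slightly above 1. Then g(z) ≈ y^{aβ} dominates g(y) ≈ y^β,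
and also (z/w) g(w) because β < 1, while (y/w)² costs only a small power of y. A positive power
remains and beats 4 log y, the amount that yields |charFun| ≤ y⁻². -/
theorem HasGrowthIndex.eventually_exists {g : ℝ → ℝ} {β : ℝ} (hg : HasGrowthIndex g β)
    (hβ : β ∈ Ioo (0 : ℝ) 1) {t : ℝ} (ht : 0 < t) :
    ∀ᶠ y in atTop, ∃ z w : ℝ, 0 < z ∧ 0 < w ∧
      4 * Real.log y ≤ 2 / 5 * (y / w) ^ 2 * (t * g z - 2 * (t * g y) - 2 * (z / w) * (t * g w)) := by
  obtain ⟨hβ0, hβ1⟩ := hβ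
  set ε : ℝ := β / 16 with hε
  set m : ℝ := min β (1 - β) with hm
  have hm0 : 0 < m := lt_min hβ0 (by linarith)
  have hmβ : m ≤ β := min_le_left _ _
  have hmβ' : m ≤ 1 - β := min_le_right _ _
  set η : ℝ := ε * m / 8 with hη
  have hε0 : 0 < ε := by positivity
  have hε1 : ε ≤ 1 / 16 := by rw [hε]; linarith
  have hη0 : 0 < η := by positivity
  have hεβ : ε * m ≤ ε * β := mul_le_mul_of_nonneg_left hmβ hε0.le
  have hεβ' : ε * m ≤ ε * (1 - β) := mul_le_mul_of_nonneg_left hmβ' hε0.le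
  have hεη : ε * η ≤ η := by nlinarith
  set a : ℝ := 1 + ε with ha
  set p : ℝ := a * (β - η) with hp
  set p₁ : ℝ := β + η with hp₁
  set p₂ : ℝ := a - a ^ 2 + a ^ 2 * (β + η) with hp₂
  set κ : ℝ := 2 - 2 * a ^ 2 + p with hκ
  have hpp₁ : 0 < p - p₁ := by
    have : p - p₁ = ε * β - (2 * η + ε * η) := by simp only [hp, hp₁, ha]; ring
    rw [this]
    nlinarith
  have hpp₂ : 0 < p - p₂ := by
    have : p - p₂ = a * (ε * (1 - β) - (2 * η + ε * η)) := by simp only [hp, hp₂, ha]; ring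
    rw [this]
    refine mul_pos (by positivity) ?_
    nlinarith
  have hκ0 : 0 < κ := by
    have h1 : κ = -(4 * ε + 2 * ε ^ 2) + β - η + ε * (β - η) := by simp only [hκ, hp, ha]; ring
    have h2 : η ≤ β / 128 := by
      have : ε * m ≤ 1 / 16 * β := mul_le_mul hε1 hmβ hm0.le (by norm_num)
      rw [hη]; linarith
    have h3 : 0 ≤ ε * (β - η) := mul_nonneg hε0.le (by linarith)
    have h4 : ε ^ 2 ≤ ε * (1 / 16) := by rw [pow_two]; exact mul_le_mul_of_nonneg_left hε1 hε0.le
    rw [h1]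
    linarith
  have ha0 : 0 < a := by positivity
  have hza : Tendsto (fun y : ℝ => y ^ a) atTop atTop := tendsto_rpow_atTop ha0
  have hwa : Tendsto (fun y : ℝ => y ^ (a ^ 2)) atTop atTop := tendsto_rpow_atTop (by positivity)
  -- The bracket will be at least t y^p / 2, so 4 log y ≤ (2/5)(t/2) y^κ is wanted. The thresholds 8
  -- below let each subtracted term cost at most a quarter of t y^p.
  have hlog := (isLittleO_log_rpow_atTop hκ0).bound (show (0 : ℝ) < t / 20 by positivity)
  filter_upwards [hg η hη0, hza.eventually (hg η hη0), hwa.eventually (hg η hη0),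
    (tendsto_rpow_atTop hpp₁).eventually_ge_atTop 8,
    (tendsto_rpow_atTop hpp₂).eventually_ge_atTop 8, hlog, eventually_ge_atTop 1]
    with y gy gz gw e1 e2 hl hy
  have hy0 : 0 < y := by linarith
  refine ⟨y ^ a, y ^ (a ^ 2), by positivity, by positivity, ?_⟩
  have hgz : y ^ p ≤ g (y ^ a) := by
    have := gz.1
    rwa [← Real.rpow_mul hy0.le] at this
  have hgy : g y ≤ y ^ p / 8 := by
    refine gy.2.trans ?_
    rw [Real.rpow_sub hy0, le_div_iff₀ (by positivity)] at e1
    linarith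
  have hgw : y ^ a / y ^ (a ^ 2) * g (y ^ (a ^ 2)) ≤ y ^ p / 8 := by
    have h1 : y ^ a / y ^ (a ^ 2) * g (y ^ (a ^ 2)) ≤ y ^ p₂ := by
      rw [hp₂, Real.rpow_add hy0 (a - a ^ 2), Real.rpow_sub hy0]
      refine mul_le_mul_of_nonneg_left ?_ (by positivity)
      rw [Real.rpow_mul hy0.le]
      exact gw.2
    refine h1.trans ?_
    rw [Real.rpow_sub hy0, le_div_iff₀ (by positivity)] at e2
    linarith
  have hbr : t * (y ^ p / 2) ≤ t * g (y ^ a) - 2 * (t * g y)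
      - 2 * (y ^ a / y ^ (a ^ 2)) * (t * g (y ^ (a ^ 2))) := by
    have := mul_le_mul_of_nonneg_left hgz ht.le
    have := mul_le_mul_of_nonneg_left hgy ht.le
    have := mul_le_mul_of_nonneg_left hgw ht.le
    nlinarith
  have hyw : (y / y ^ (a ^ 2)) ^ 2 = y ^ (2 - 2 * a ^ 2) := by
    rw [Real.rpow_sub hy0, div_pow, mul_comm 2 (a ^ 2), Real.rpow_mul hy0.le]
    norm_cast
  have hl' : Real.log y ≤ t / 20 * y ^ κ := by
    have := (le_abs_self _).trans hl
    rwa [Real.norm_of_nonneg (by positivity)] at this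
  calc 4 * Real.log y ≤ 2 / 5 * y ^ (2 - 2 * a ^ 2) * (t * (y ^ p / 2)) := by
        rw [hκ, Real.rpow_add hy0] at hl'
        linarith
    _ ≤ _ := by
        rw [hyw]
        exact mul_le_mul_of_nonneg_left hbr (by positivity)

theorem integrable_of_norm_le_inv_sq {f : ℝ → ℂ} (hf : Continuous f) (h1 : ∀ y, ‖f y‖ ≤ 1)
    (hneg : ∀ y, ‖f (-y)‖ = ‖f y‖) (h2 : ∀ᶠ y in atTop, ‖f y‖ ≤ (y ^ 2)⁻¹) : Integrable f := by
  obtain ⟨Y, hY⟩ := eventually_atTop.1 h2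
  set R := max Y 1 with hR
  refine (integrable_inv_one_add_sq.const_mul (2 + R ^ 2)).mono' hf.aestronglyMeasurable
    (ae_of_all _ fun y => ?_)
  have habs : ‖f y‖ = ‖f |y|‖ := by
    rcases abs_choice y with h | h <;> rw [h]
    rw [hneg]
  rw [habs, ← sq_abs y, ← div_eq_mul_inv, le_div_iff₀ (by positivity)]
  rcases le_total |y| R with h | h
  · have h3 : |y| ^ 2 ≤ R ^ 2 := pow_le_pow_left₀ (abs_nonneg y) h 2
    nlinarith [h1 |y|, norm_nonneg (f |y|)]
  · have h4 := hY |y| ((le_max_left _ _).trans h)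
    have h5 : 1 ≤ |y| := (le_max_right _ _).trans h
    have h6 : (1 : ℝ) ≤ |y| ^ 2 := one_le_pow₀ h5
    have h7 : (|y| ^ 2)⁻¹ * (1 + |y| ^ 2) ≤ 2 := by
      rw [inv_mul_le_iff₀ (by positivity)]
      linarith
    have := mul_le_mul_of_nonneg_right h4 (show 0 ≤ 1 + |y| ^ 2 by positivity)
    nlinarith [sq_nonneg R]

theorem IsSubordinator.absolutelyContinuous {g : ℝ → ℝ} {P : ℝ → Measure ℝ}
    (hP : IsSubordinator g P) {β : ℝ} (hg : HasGrowthIndex g β) (hβ : β ∈ Ioo (0 : ℝ) 1) {t : ℝ}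
    (ht : 0 < t) : P t ≪ volume := by
  have := hP.isProbabilityMeasure t ht
  refine absolutelyContinuous_of_integrable_charFun (integrable_of_norm_le_inv_sq
    continuous_charFun norm_charFun_le_one (fun y => ?_) ?_)
  · rw [charFun_neg, RCLike.norm_conj]
  · filter_upwards [hg.eventually_exists hβ ht, eventually_gt_atTop 0] with y ⟨z, w, hz, hw, h⟩ hy
    have h1 := (hP.norm_sq_charFun_le ht hy hz hw).trans
      (Real.exp_le_exp.2 (neg_le_neg h))
    have h2 : Real.exp (-(4 * Real.log y)) = ((y ^ 2)⁻¹) ^ 2 := by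
      rw [Real.exp_neg, mul_comm, Real.exp_mul, Real.exp_log hy]
      norm_cast
      rw [inv_pow, ← pow_mul]
    rw [h2] at h1
    exact le_of_sq_le_sq h1 (by positivity)

end Growth

/-! ### Uniqueness of the Laplace transform of functions -/

section DensityMeasure

/-- The measure on `(0, ∞)` with density `f`. -/
def densityMeasure (f : ℝ → ℝ) : Measure ℝ :=
  (volume.restrict (Ioi 0)).withDensity fun t => ENNReal.ofReal (f t)

theorem densityMeasure_Iio_zero (f : ℝ → ℝ) : densityMeasure f (Iio 0) = 0 := by
  refine withDensity_absolutelyContinuous _ _ ?_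
  rw [Measure.restrict_apply measurableSet_Iio]
  convert! measure_empty (μ := (volume : Measure ℝ))
  ext x
  simp only [mem_inter_iff, mem_Iio, mem_Ioi, mem_empty_iff_false, iff_false, not_and, not_lt]
  exact fun h => h.le

theorem isFiniteMeasure_densityMeasure {f : ℝ → ℝ} (hf : IntegrableOn f (Ioi 0)) :
    IsFiniteMeasure (densityMeasure f) :=
  isFiniteMeasure_withDensity_ofReal hf.hasFiniteIntegral

theorem measureLaplace_densityMeasure {f : ℝ → ℝ} (hf : IntegrableOn f (Ioi 0))
    (h0 : ∀ t, 0 < t → 0 ≤ f t) (s : ℝ) :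
    measureLaplace (densityMeasure f) s = laplaceTransform f s := by
  unfold measureLaplace densityMeasure laplaceTransform
  rw [integral_withDensity_eq_integral_toReal_smul₀ hf.aestronglyMeasurable.aemeasurable.ennreal_ofReal
    (ae_of_all _ fun _ => ENNReal.ofReal_lt_top)]
  refine setIntegral_congr_fun measurableSet_Ioi fun t ht => ?_
  simp only [ENNReal.toReal_ofReal (h0 t ht), smul_eq_mul, mul_comm]

theorem integrableOn_exp_mul {f : ℝ → ℝ} (hf : IntegrableOn f (Ioi 0)) {s : ℝ} (hs : 0 ≤ s) :
    IntegrableOn (fun t => Real.exp (-(s * t)) * f t) (Ioi 0) := by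
  refine Integrable.bdd_mul hf (c := 1) (by fun_prop) ?_
  filter_upwards [ae_restrict_mem measurableSet_Ioi] with t ht
  rw [Real.norm_of_nonneg (Real.exp_pos _).le, Real.exp_le_one_iff, neg_nonpos]
  exact mul_nonneg hs (le_of_lt ht)

/-- A function is determined almost everywhere by its Laplace transform. -/
theorem ae_eq_zero_of_laplaceTransform {f : ℝ → ℝ} (hf : HasLaplaceTransform f fun _ => 0) :
    ∀ᵐ t ∂(volume.restrict (Ioi (0 : ℝ))), f t = 0 := by
  -- The factor e^{-t} makes the function integrable, so its positive and negative parts give finite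
  -- measures with equal transforms.
  set h : ℝ → ℝ := fun t => Real.exp (-(1 * t)) * f t with hh
  have hi : IntegrableOn h (Ioi 0) := (hf 1 one_pos).1
  have hip : IntegrableOn (fun t => max (h t) 0) (Ioi 0) := hi.pos_part
  have hin : IntegrableOn (fun t => max (-h t) 0) (Ioi 0) := hi.neg_part
  have f1 := isFiniteMeasure_densityMeasure hip
  have f2 := isFiniteMeasure_densityMeasure hin
  have heq : densityMeasure (fun t => max (h t) 0) = densityMeasure (fun t => max (-h t) 0) := by
    refine measure_ext_of_measureLaplace (densityMeasure_Iio_zero _) (densityMeasure_Iio_zero _)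
      fun s hs => ?_
    rw [measureLaplace_densityMeasure hip fun t _ => le_max_right _ _,
      measureLaplace_densityMeasure hin fun t _ => le_max_right _ _, ← sub_eq_zero]
    unfold laplaceTransform
    rw [← integral_sub (integrableOn_exp_mul hip hs.le) (integrableOn_exp_mul hin hs.le)]
    have := (hf (s + 1) (by positivity)).2
    refine Eq.trans ?_ this
    unfold laplaceTransform
    refine integral_congr_ae (ae_of_all _ fun t => ?_)
    simp only
    have e1 : max (h t) 0 - max (-h t) 0 = h t := by
      rcases le_total (h t) 0 with H | H
      · rw [max_eq_right H, max_eq_left (by linarith)]; ring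
      · rw [max_eq_left H, max_eq_right (by linarith)]; ring
    rw [← mul_sub, e1, hh, ← mul_assoc, ← Real.exp_add]
    ring_nf
  unfold densityMeasure at heq
  rw [withDensity_eq_iff hip.aestronglyMeasurable.aemeasurable.ennreal_ofReal
    hin.aestronglyMeasurable.aemeasurable.ennreal_ofReal hip.lintegral_lt_top.ne] at heq
  filter_upwards [heq] with t ht
  rw [ENNReal.ofReal_eq_ofReal_iff (le_max_right _ _) (le_max_right _ _)] at ht
  have h0 : h t = 0 := by
    rcases le_total (h t) 0 with H | H
    · rw [max_eq_right H, max_eq_left (by linarith)] at ht; linarith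
    · rw [max_eq_left H, max_eq_right (by linarith)] at ht; linarith
  exact (mul_eq_zero.1 h0).resolve_left (Real.exp_pos _).ne'

end DensityMeasure

/-! ### The law of a subordinator at an exponential time -/

section Resolvent

variable {g : ℝ → ℝ} {lam : ℝ}

theorem integral_exp_neg_mul_Ioi {c : ℝ} (hc : 0 < c) (a : ℝ) :
    ∫ t in Ioi a, Real.exp (-(c * t)) = Real.exp (-(c * a)) / c := by
  have := integral_exp_mul_Ioi (neg_lt_zero.2 hc) a
  simp only [neg_mul] at this
  rw [this, neg_div_neg_eq]

theorem integrableOn_exp_neg_mul_Ioi {c : ℝ} (hc : 0 < c) (a : ℝ) :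
    IntegrableOn (fun t => Real.exp (-(c * t))) (Ioi a) := by
  simpa only [neg_mul] using integrableOn_exp_mul_Ioi (neg_lt_zero.2 hc) a

theorem laplaceTransform_exp_tail (hlam : 0 < lam) {δ : ℝ} (hδ : 0 ≤ δ) {x : ℝ} (hx : 0 ≤ x) :
    laplaceTransform ((Ioi δ).indicator fun t => lam * Real.exp (-(lam * t))) x
      = Real.exp (-(lam * δ)) * Real.exp (-(δ * x)) * (lam / (lam + x)) := by
  unfold laplaceTransform
  have h1 : ∀ t, Real.exp (-(x * t)) * (Ioi δ).indicator (fun t => lam * Real.exp (-(lam * t))) t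
      = (Ioi δ).indicator (fun t => lam * Real.exp (-((lam + x) * t))) t := fun t => by
    by_cases ht : t ∈ Ioi δ
    · rw [indicator_of_mem ht, indicator_of_mem ht, mul_left_comm, ← Real.exp_add]
      ring_nf
    · simp [indicator_of_notMem ht]
  simp_rw [h1]
  rw [setIntegral_indicator measurableSet_Ioi,
    inter_eq_right.2 (Ioi_subset_Ioi hδ), integral_const_mul,
    integral_exp_neg_mul_Ioi (by positivity), ← Real.exp_add]
  rw [show -((lam + x) * δ) = -(lam * δ) + -(δ * x) by ring]
  ring

/-- Subordinating the exponential law of rate `lam` gives the transform lam/(lam + g). Absolute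
continuity is inherited from P_δ for small δ, so no integrability of the characteristic function of
μ itself is needed. -/
theorem exists_resolvent (hg : IsBernsteinFunction g) (hpos : ∀ x, 0 < x → 0 < g x)
    (h0 : Tendsto g (𝓝[>] 0) (𝓝 0)) {β : ℝ} (hgr : HasGrowthIndex g β) (hβ : β ∈ Ioo (0 : ℝ) 1)
    (hlam : 0 < lam) :
    ∃ μ : Measure ℝ, IsProbabilityMeasure μ ∧ μ (Iio 0) = 0 ∧ μ ≪ volume ∧
      ∀ s, 0 < s → measureLaplace μ s = lam / (lam + g s) := by
  obtain ⟨P, hP⟩ := hg.exists_isSubordinator hpos h0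
  have hexp : IntegrableOn (fun t => lam * Real.exp (-(lam * t))) (Ioi 0) :=
    (integrableOn_exp_neg_mul_Ioi hlam 0).const_mul lam
  let tail : ℝ → ℝ → ℝ := fun δ => (Ioi δ).indicator fun t => lam * Real.exp (-(lam * t))
  let head : ℝ → ℝ → ℝ := fun δ => (Iic δ).indicator fun t => lam * Real.exp (-(lam * t))
  have htail0 : ∀ δ t, 0 ≤ tail δ t := fun δ => indicator_nonneg fun t _ => by positivity
  have hhead0 : ∀ δ t, 0 ≤ head δ t := fun δ => indicator_nonneg fun t _ => by positivity
  have htaili : ∀ δ, IntegrableOn (tail δ) (Ioi 0) := fun δ => hexp.indicator measurableSet_Ioi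
  have hheadi : ∀ δ, IntegrableOn (head δ) (Ioi 0) := fun δ => hexp.indicator measurableSet_Iic
  have hsum : ∀ δ, 0 ≤ δ → ∀ x, 0 ≤ x →
      laplaceTransform (head δ) x + laplaceTransform (tail δ) x = laplaceTransform (tail 0) x := by
    intro δ hδ x hx
    unfold laplaceTransform
    rw [← integral_add (integrableOn_exp_mul (hheadi δ) hx) (integrableOn_exp_mul (htaili δ) hx)]
    refine setIntegral_congr_fun measurableSet_Ioi fun t ht => ?_
    simp only [tail, head, ← mul_add]
    congr 1
    rw [indicator_of_mem ht]
    by_cases h : t ≤ δ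
    · rw [indicator_of_mem (mem_Iic.2 h), indicator_of_notMem (by simpa using h), add_zero]
    · rw [indicator_of_notMem (by simpa using h), indicator_of_mem (by simpa using h), zero_add]
  have htl : ∀ δ, 0 ≤ δ → ∀ x, 0 ≤ x → laplaceTransform (tail δ) x
      = Real.exp (-(lam * δ)) * Real.exp (-(δ * x)) * (lam / (lam + x)) :=
    fun δ hδ x hx => laplaceTransform_exp_tail hlam hδ hx
  have hmass : ∀ f : ℝ → ℝ, IntegrableOn f (Ioi 0) → (∀ t, 0 ≤ f t) →
      densityMeasure f univ = ENNReal.ofReal (laplaceTransform f 0) := by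
    intro f hf hf0
    have := isFiniteMeasure_densityMeasure hf
    rw [← measureLaplace_densityMeasure hf (fun t _ => hf0 t), ← ofReal_measureReal]
    simp [measureLaplace]
  have fT := isFiniteMeasure_densityMeasure (htaili 0)
  obtain ⟨μ, hμf, hμ0, hμm, hμl⟩ := exists_subordinate hg hpos h0 (densityMeasure (tail 0))
    (densityMeasure_Iio_zero _)
  have hμl' : ∀ s, 0 < s → measureLaplace μ s = lam / (lam + g s) := fun s hs => by
    rw [hμl s hs, measureLaplace_densityMeasure (htaili 0) (fun t _ => htail0 0 t),
      htl 0 le_rfl _ (hpos s hs).le]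
    simp
  have hμp : IsProbabilityMeasure μ := ⟨by
    rw [hμm, hmass _ (htaili 0) (htail0 0), htl 0 le_rfl 0 le_rfl]
    simp [hlam.ne']⟩
  refine ⟨μ, hμp, hμ0, ?_, hμl'⟩
  refine Measure.AbsolutelyContinuous.mk fun N hN hN0 => ?_
  have hbound : ∀ δ, 0 < δ → μ N ≤ ENNReal.ofReal (1 - Real.exp (-(lam * δ))) := by
    intro δ hδ
    have fH := isFiniteMeasure_densityMeasure (hheadi δ)
    obtain ⟨μ₁, h1f, h10, h1m, h1l⟩ := exists_subordinate hg hpos h0 (densityMeasure (head δ))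
      (densityMeasure_Iio_zero _)
    have := hP.isProbabilityMeasure δ hδ
    -- Lack of memory: given that the exponential time exceeds δ, the subordinator restarts from its
    -- position at time δ. Hence a Lebesgue-null set is charged only by μ₁, whose mass is 1 -
    -- e^{-lam δ}.
    have hdec : μ = μ₁ + ENNReal.ofReal (Real.exp (-(lam * δ))) • (μ ∗ P δ) := by
      have hconv0 := conv_Iio_zero hμ0 (hP.Iio_zero δ hδ)
      have : IsFiniteMeasure (ENNReal.ofReal (Real.exp (-(lam * δ))) • (μ ∗ P δ)) :=
        (μ ∗ P δ).smul_finite ENNReal.ofReal_ne_top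
      have hzero : (ENNReal.ofReal (Real.exp (-(lam * δ))) • (μ ∗ P δ)) (Iio 0) = 0 := by
        simp [hconv0]
      refine measure_ext_of_measureLaplace hμ0 (by simp [h10, hconv0]) fun s hs => ?_
      have e1 : measureLaplace (μ₁ + ENNReal.ofReal (Real.exp (-(lam * δ))) • (μ ∗ P δ)) s
          = measureLaplace μ₁ s + Real.exp (-(lam * δ)) * measureLaplace (μ ∗ P δ) s := by
        unfold measureLaplace
        rw [integral_add_measure (integrable_exp_neg_mul h10 hs.le)
          (integrable_exp_neg_mul hzero hs.le), integral_smul_measure,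
          ENNReal.toReal_ofReal (Real.exp_pos _).le, smul_eq_mul]
      have e2 := hsum δ hδ.le (g s) (hpos s hs).le
      have e3 : measureLaplace μ₁ s = laplaceTransform (head δ) (g s) := by
        rw [h1l s hs, measureLaplace_densityMeasure (hheadi δ) (fun t _ => hhead0 δ t)]
      have e4 : measureLaplace μ s = laplaceTransform (tail 0) (g s) := by
        rw [hμl s hs, measureLaplace_densityMeasure (htaili 0) (fun t _ => htail0 0 t)]
      rw [htl δ hδ.le _ (hpos s hs).le, ← e4, hμl' s hs] at e2
      rw [e1, measureLaplace_conv hμ0 (hP.Iio_zero δ hδ) hs.le, e3, hμl' s hs,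
        hP.laplace δ hδ s hs]
      linear_combination -e2
    have hac : μ ∗ P δ ≪ volume :=
      Measure.conv_absolutelyContinuous (hP.absolutelyContinuous hgr hβ hδ)
    rw [hdec, Measure.add_apply, Measure.smul_apply, hac hN0, smul_zero, add_zero]
    refine (measure_mono (subset_univ N)).trans_eq ?_
    rw [h1m, hmass _ (hheadi δ) (hhead0 δ)]
    congr 1
    have := hsum δ hδ.le 0 le_rfl
    rw [htl δ hδ.le 0 le_rfl, htl 0 le_rfl 0 le_rfl] at this
    simp only [mul_zero, neg_zero, Real.exp_zero, add_zero, div_self hlam.ne', mul_one] at this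
    linarith
  have hlim : Tendsto (fun δ => ENNReal.ofReal (1 - Real.exp (-(lam * δ)))) (𝓝[>] 0) (𝓝 0) := by
    have : Continuous fun δ => ENNReal.ofReal (1 - Real.exp (-(lam * δ))) :=
      ENNReal.continuous_ofReal.comp (by fun_prop)
    simpa using (this.tendsto 0).mono_left (nhdsWithin_le_nhds (s := Ioi 0))
  refine le_antisymm (ge_of_tendsto hlim ?_) bot_le
  filter_upwards [self_mem_nhdsWithin] with δ hδ using hbound δ hδ

end Resolvent

/-! ### The kernel as the tail of the Lévy measure -/

section LevyKernel

variable {g : ℝ → ℝ}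

theorem IsCompletelyMonotone.comp_add_const {f : ℝ → ℝ} (hf : IsCompletelyMonotone f) {a : ℝ}
    (ha : 0 ≤ a) : IsCompletelyMonotone (fun s => f (s + a)) := by
  refine ⟨hf.contDiffOn.comp (by fun_prop) fun x (hx : 0 < x) => ?_, fun n x hx => ?_⟩
  · exact mem_Ioi.2 (by positivity)
  · rw [iteratedDeriv_comp_add_const]
    exact hf.nonneg n (x + a) (by positivity)

theorem lintegral_exp_neg_mul {μ : Measure ℝ} [IsFiniteMeasure μ] (hμ : μ (Iio 0) = 0) {s : ℝ}
    (hs : 0 ≤ s) :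
    ∫⁻ t, ENNReal.ofReal (Real.exp (-(s * t))) ∂μ = ENNReal.ofReal (measureLaplace μ s) := by
  unfold measureLaplace
  rw [ofReal_integral_eq_lintegral_ofReal (integrable_exp_neg_mul hμ hs)
    (ae_of_all _ fun t => (Real.exp_pos _).le)]

/-- Bernstein's theorem without boundedness at `0`. -/
theorem IsCompletelyMonotone.exists_measure_lintegral {f : ℝ → ℝ} (hf : IsCompletelyMonotone f) :
    ∃ m : Measure ℝ, SFinite m ∧ m (Iio 0) = 0 ∧
      ∀ s, 0 < s → ∫⁻ t, ENNReal.ofReal (Real.exp (-(s * t))) ∂m = ENNReal.ofReal (f s) := by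
  have hex : ∀ a : ℝ, 0 < a → ∃ μ : Measure ℝ, IsFiniteMeasure μ ∧ μ (Iio 0) = 0 ∧
      ∀ s, 0 < s → measureLaplace μ s = f (s + a) := by
    intro a ha
    have hlim : Tendsto (fun s => f (s + a)) (𝓝[>] 0) (𝓝 (f a)) := by
      have h1 : Tendsto (fun s : ℝ => s + a) (𝓝[>] 0) (𝓝 a) := by
        have : Continuous fun s : ℝ => s + a := by fun_prop
        simpa using (this.tendsto 0).mono_left (nhdsWithin_le_nhds (s := Ioi 0))
      exact (hf.continuousAt ha).tendsto.comp h1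
    obtain ⟨μ, h1, h2, -, h3⟩ := (hf.comp_add_const ha.le).exists_measure hlim
    exact ⟨μ, h1, h2, h3⟩
  obtain ⟨μ₁, hf1, h10, h1l⟩ := hex 1 one_pos
  refine ⟨μ₁.withDensity fun t => ENNReal.ofReal (Real.exp t), inferInstance,
    withDensity_absolutelyContinuous _ _ h10, fun s hs => ?_⟩
  -- The representing measure of f(· + 1), tilted back by e^t, must work for every s > 0. A shift a
  -- < min(s, 1) gives another finite measure that controls s, and uniqueness identifies it with the
  -- first up to the tilt.
  set a : ℝ := min (s / 2) (1 / 2) with ha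
  have ha0 : 0 < a := lt_min (by positivity) (by norm_num)
  have has : a < s := (min_le_left _ _).trans_lt (by linarith)
  have ha1 : a < 1 := (min_le_right _ _).trans_lt (by norm_num)
  obtain ⟨μ, hfμ, hμ0, hμl⟩ := hex a ha0
  have hi : Integrable (fun t => Real.exp (-((1 - a) * t))) μ :=
    integrable_exp_neg_mul hμ0 (by linarith)
  have hfin : IsFiniteMeasure (μ.withDensity fun t => ENNReal.ofReal (Real.exp (-((1 - a) * t)))) :=
    isFiniteMeasure_withDensity_ofReal hi.hasFiniteIntegral
  have heq : μ₁ = μ.withDensity fun t => ENNReal.ofReal (Real.exp (-((1 - a) * t))) := by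
    refine measure_ext_of_measureLaplace h10 (withDensity_absolutelyContinuous _ _ hμ0)
      fun x hx => ?_
    have h2 := hμl (x + (1 - a)) (by linarith)
    rw [h1l x hx, show x + 1 = x + (1 - a) + a by ring, ← h2]
    unfold measureLaplace
    rw [integral_withDensity_eq_integral_toReal_smul (by fun_prop)
      (ae_of_all _ fun _ => ENNReal.ofReal_lt_top)]
    refine integral_congr_ae (ae_of_all _ fun t => ?_)
    simp only [ENNReal.toReal_ofReal (Real.exp_pos _).le, smul_eq_mul]
    rw [← Real.exp_add]
    ring_nf
  have h3 := hμl (s - a) (by linarith)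
  rw [sub_add_cancel] at h3
  rw [lintegral_withDensity_eq_lintegral_mul _ (by fun_prop) (by fun_prop), heq,
    lintegral_withDensity_eq_lintegral_mul _ (by fun_prop) (by fun_prop), ← h3,
    ← lintegral_exp_neg_mul hμ0 (by linarith)]
  refine lintegral_congr fun t => ?_
  simp only [Pi.mul_apply]
  rw [← ENNReal.ofReal_mul (by positivity), ← ENNReal.ofReal_mul (by positivity),
    ← Real.exp_add, ← Real.exp_add]
  ring_nf

theorem IsBernsteinFunction.hasDerivAt (hg : IsBernsteinFunction g) {x : ℝ} (hx : 0 < x) :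
    HasDerivAt g (deriv g x) x := by
  have := hg.1.hasDerivAt_iteratedDeriv 0 hx
  rwa [iteratedDeriv_zero, zero_add, iteratedDeriv_one] at this

theorem IsBernsteinFunction.lintegral_deriv (hg : IsBernsteinFunction g)
    (h0 : Tendsto g (𝓝[>] 0) (𝓝 0)) {s : ℝ} (hs : 0 < s) :
    ∫⁻ x in Ioc 0 s, ENNReal.ofReal (deriv g x) = ENNReal.ofReal (g s) := by
  -- The value of `g` at 0 is unconstrained; replacing it by the limit gives continuity on [0, s].
  set G : ℝ → ℝ := Function.update g 0 0 with hG
  have hGg : ∀ x, 0 < x → G x = g x := fun x hx => Function.update_of_ne hx.ne' _ _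
  have hd : ∀ x ∈ Ioo 0 s, HasDerivAt G (deriv g x) x := fun x hx =>
    (hg.hasDerivAt hx.1).congr_of_eventuallyEq (by
      filter_upwards [Ioi_mem_nhds hx.1] with y hy using hGg y hy)
  have hc : ContinuousOn G (Icc 0 s) := by
    intro x hx
    rcases hx.1.eq_or_lt with h | h
    · subst h
      have h1 : ContinuousWithinAt G (Ioi 0) 0 := by
        refine Tendsto.congr' (f₁ := g) ?_ (by simpa [hG] using h0)
        filter_upwards [self_mem_nhdsWithin] with y hy using (hGg y hy).symm
      exact (continuousWithinAt_Ioi_iff_Ici.1 h1).mono Icc_subset_Ici_self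
    · refine ((hg.hasDerivAt h).continuousAt.congr ?_).continuousWithinAt
      filter_upwards [Ioi_mem_nhds h] with y hy using (hGg y hy).symm
  have hnn : ∀ x ∈ Ioo 0 s, 0 ≤ deriv g x := fun x hx => hg.isCompletelyMonotone_deriv.nonneg' hx.1
  have hi := intervalIntegral.integrableOn_deriv_of_nonneg hc hd hnn
  rw [← ofReal_integral_eq_lintegral_ofReal hi, ← intervalIntegral.integral_of_le hs.le,
    intervalIntegral.integral_eq_sub_of_hasDerivAt_of_le hs.le hc hd
      ((intervalIntegrable_iff_integrableOn_Ioc_of_le hs.le).2 hi), hGg s hs]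
  · simp [hG]
  · filter_upwards [ae_restrict_mem measurableSet_Ioc] with x hx using hg.isCompletelyMonotone_deriv.nonneg' hx.1

/-- The derivative is non-increasing, so s g'(s) is at most the integral of g' over (0, s]. -/
theorem IsBernsteinFunction.mul_deriv_le (hg : IsBernsteinFunction g)
    (h0 : Tendsto g (𝓝[>] 0) (𝓝 0)) {s : ℝ} (hs : 0 < s) : s * deriv g s ≤ g s := by
  have h1 : ENNReal.ofReal (s * deriv g s) ≤ ENNReal.ofReal (g s) := by
    rw [← hg.lintegral_deriv h0 hs, mul_comm, ENNReal.ofReal_mul (hg.isCompletelyMonotone_deriv.nonneg' hs)]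
    calc _ = ∫⁻ x in Ioc 0 s, ENNReal.ofReal (deriv g s) := by simp
      _ ≤ _ := setLIntegral_mono' measurableSet_Ioc fun x hx =>
        ENNReal.ofReal_le_ofReal (hg.isCompletelyMonotone_deriv.antitoneOn hx.1 hs hx.2)
  exact (ENNReal.ofReal_le_ofReal_iff (hg.2.1 s hs)).1 h1

theorem lintegral_Ioc_exp {c b : ℝ} (hc : 0 < c) (hb : 0 ≤ b) :
    ∫⁻ t in Ioc 0 b, ENNReal.ofReal (Real.exp (-(c * t)))
      = ENNReal.ofReal ((1 - Real.exp (-(c * b))) / c) := by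
  have hi : IntegrableOn (fun t => Real.exp (-(c * t))) (Ioc 0 b) :=
    (integrableOn_exp_neg_mul_Ioi hc 0).mono_set Ioc_subset_Ioi_self
  rw [← ofReal_integral_eq_lintegral_ofReal hi (ae_of_all _ fun t => (Real.exp_pos _).le)]
  congr 1
  have h1 : ∀ x ∈ uIcc 0 b, HasDerivAt (fun t => -Real.exp (-(c * t)) / c) (Real.exp (-(c * x))) x := by
    intro x _
    have := ((((hasDerivAt_id x).const_mul c).neg).exp).neg.div_const c
    convert! this using 1
    simp only [id, Pi.neg_apply]
    field_simp
  rw [← intervalIntegral.integral_of_le hb, intervalIntegral.integral_eq_sub_of_hasDerivAt h1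
    (Continuous.intervalIntegrable (by fun_prop) _ _)]
  simp
  ring

/-- The tail of the Lévy measure of `g` is the inverse Laplace transform of `g s / s`. -/
theorem IsBernsteinFunction.exists_kernel (hg : IsBernsteinFunction g)
    (h0 : Tendsto g (𝓝[>] 0) (𝓝 0)) (htop : Tendsto (fun s => g s / s) atTop (𝓝 0)) :
    ∃ φ : ℝ → ℝ, HasLaplaceTransform φ (fun s => g s / s) := by
  obtain ⟨m, hm, hm0, hml⟩ := hg.isCompletelyMonotone_deriv.exists_measure_lintegral
  -- The atom at 0 is the drift of `g`: it is bounded by g'(s) ≤ g(s)/s, which tends to 0.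
  have hatom : m {0} = 0 := by
    refine le_antisymm (ge_of_tendsto (f := fun s => ENNReal.ofReal (g s / s)) (x := atTop) ?_ ?_)
      bot_le
    · simpa using ENNReal.tendsto_ofReal htop
    · filter_upwards [eventually_gt_atTop 0] with s hs
      calc m {0} = ∫⁻ t in {0}, ENNReal.ofReal (Real.exp (-(s * t))) ∂m := by simp
        _ ≤ ∫⁻ t, ENNReal.ofReal (Real.exp (-(s * t))) ∂m := setLIntegral_le_lintegral _ _
        _ = ENNReal.ofReal (deriv g s) := hml s hs
        _ ≤ _ := ENNReal.ofReal_le_ofReal (by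
            rw [le_div_iff₀ hs, mul_comm]; exact hg.mul_deriv_le h0 hs)
  have hpos : ∀ᵐ r ∂m, 0 < r := by
    filter_upwards [ae_nonneg_of_measure_Iio hm0, compl_mem_ae_iff.2 hatom] with r h1 h2
    exact lt_of_le_of_ne h1 (Ne.symm h2)
  let k : ℝ → ℝ → ENNReal := fun t r => (Ioi t).indicator (fun r => ENNReal.ofReal r⁻¹) r
  have hk : Measurable (Function.uncurry k) := by
    have : Function.uncurry k = {p : ℝ × ℝ | p.1 < p.2}.indicator
        (fun p => ENNReal.ofReal p.2⁻¹) := by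
      ext ⟨t, r⟩
      simp [k, Function.uncurry, indicator]
    rw [this]
    exact Measurable.indicator (by fun_prop) (measurableSet_lt measurable_fst measurable_snd)
  let Φ : ℝ → ENNReal := fun t => ∫⁻ r, k t r ∂m
  have hΦ : Measurable Φ := hk.lintegral_prod_right
  have key : ∀ s, 0 < s → ∫⁻ t in Ioi 0, ENNReal.ofReal (Real.exp (-(s * t))) * Φ t
      = ENNReal.ofReal (g s / s) := by
    intro s hs
    have e1 : ∀ t, ENNReal.ofReal (Real.exp (-(s * t))) * Φ t
        = ∫⁻ r, ENNReal.ofReal (Real.exp (-(s * t))) * k t r ∂m := fun t =>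
      (lintegral_const_mul _ (hk.comp measurable_prodMk_left)).symm
    simp_rw [e1]
    rw [lintegral_lintegral_swap]
    swap
    · exact (Measurable.mul (by fun_prop) hk).aemeasurable
    -- Both sides equal (1 - e^{-sr})/(sr). A second Fubini then turns the integral against `m` into
    -- s⁻¹ ∫₀ˢ g' = g(s)/s.
    have e2 : ∀ᵐ r ∂m, ∫⁻ t in Ioi 0, ENNReal.ofReal (Real.exp (-(s * t))) * k t r
        = ENNReal.ofReal s⁻¹ * ∫⁻ x in Ioc 0 s, ENNReal.ofReal (Real.exp (-(x * r))) := by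
      filter_upwards [hpos] with r hr
      have e3 : ∀ t, ENNReal.ofReal (Real.exp (-(s * t))) * k t r
          = (Iio r).indicator (fun t => ENNReal.ofReal (Real.exp (-(s * t))) * ENNReal.ofReal r⁻¹) t :=
        fun t => by
          by_cases h : t < r
          · simp [k, indicator, h]
          · simp [k, indicator, h]
      simp_rw [e3, mul_comm _ r]
      rw [lintegral_indicator measurableSet_Iio, Measure.restrict_restrict measurableSet_Iio,
        inter_comm, Ioi_inter_Iio, setLIntegral_congr Ioo_ae_eq_Ioc,
        lintegral_mul_const _ (by fun_prop), lintegral_Ioc_exp hs hr.le, lintegral_Ioc_exp hr hs.le,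
        ← ENNReal.ofReal_mul' (by positivity), ← ENNReal.ofReal_mul (by positivity)]
      congr 1
      rw [mul_comm r s]
      ring
    rw [lintegral_congr_ae e2, lintegral_const_mul' _ _ ENNReal.ofReal_ne_top,
      lintegral_lintegral_swap (by fun_prop), setLIntegral_congr_fun measurableSet_Ioc
        (g := fun x => ENNReal.ofReal (deriv g x)) (fun x hx => hml x hx.1),
      hg.lintegral_deriv h0 hs, ← ENNReal.ofReal_mul (by positivity), inv_mul_eq_div]
  have hfin : ∀ᵐ t ∂(volume.restrict (Ioi (0 : ℝ))), Φ t < ⊤ := by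
    have := ae_lt_top (μ := volume.restrict (Ioi (0 : ℝ)))
      (f := fun t => ENNReal.ofReal (Real.exp (-(1 * t))) * Φ t) (by fun_prop)
      (by rw [key 1 one_pos]; exact ENNReal.ofReal_ne_top)
    filter_upwards [this] with t ht
    refine lt_top_iff_ne_top.2 fun h => ?_
    rw [h, ENNReal.mul_top (by simpa using Real.exp_pos _)] at ht
    exact lt_irrefl _ ht
  refine ⟨fun t => (Φ t).toReal, fun s hs => ?_⟩
  have e4 : ∀ᵐ t ∂(volume.restrict (Ioi (0 : ℝ))),
      ENNReal.ofReal (Real.exp (-(s * t)) * (Φ t).toReal)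
        = ENNReal.ofReal (Real.exp (-(s * t))) * Φ t := by
    filter_upwards [hfin] with t ht
    rw [ENNReal.ofReal_mul (Real.exp_pos _).le, ENNReal.ofReal_toReal ht.ne]
  have hnn : 0 ≤ᵐ[volume.restrict (Ioi (0 : ℝ))] fun t => Real.exp (-(s * t)) * (Φ t).toReal :=
    ae_of_all _ fun t => mul_nonneg (Real.exp_pos _).le ENNReal.toReal_nonneg
  have hms : AEStronglyMeasurable (fun t => Real.exp (-(s * t)) * (Φ t).toReal)
      (volume.restrict (Ioi (0 : ℝ))) :=
    (Measurable.mul (by fun_prop) hΦ.ennreal_toReal).aestronglyMeasurable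
  have e5 : ∫⁻ t in Ioi 0, ENNReal.ofReal (Real.exp (-(s * t)) * (Φ t).toReal)
      = ENNReal.ofReal (g s / s) := by rw [lintegral_congr_ae e4, key s hs]
  refine ⟨(lintegral_ofReal_ne_top_iff_integrable hms hnn).1 (by
    rw [e5]; exact ENNReal.ofReal_ne_top), ?_⟩
  unfold laplaceTransform
  rw [integral_eq_lintegral_of_nonneg_ae hnn hms, e5,
    ENNReal.toReal_ofReal (div_nonneg (hg.2.1 s hs) hs.le)]

end LevyKernel

/-! ### Calculus of Laplace transforms and convolution -/

namespace HasLaplaceTransform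

variable {a b A B : ℝ → ℝ}

theorem congr_right (ha : HasLaplaceTransform a A) (h : ∀ s, 0 < s → A s = B s) :
    HasLaplaceTransform a B := fun s hs => ⟨(ha s hs).1, (ha s hs).2.trans (h s hs)⟩

theorem add (ha : HasLaplaceTransform a A) (hb : HasLaplaceTransform b B) :
    HasLaplaceTransform (fun t => a t + b t) (fun s => A s + B s) := fun s hs => by
  simp only [laplaceTransform, mul_add]
  refine ⟨(ha s hs).1.add (hb s hs).1, ?_⟩
  rw [integral_add (ha s hs).1 (hb s hs).1]
  exact congrArg₂ _ (ha s hs).2 (hb s hs).2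

theorem const_mul (ha : HasLaplaceTransform a A) (c : ℝ) :
    HasLaplaceTransform (fun t => c * a t) (fun s => c * A s) := fun s hs => by
  simp only [laplaceTransform, mul_left_comm _ c]
  refine ⟨(ha s hs).1.const_mul c, ?_⟩
  rw [integral_const_mul]
  exact congrArg _ (ha s hs).2

theorem sub (ha : HasLaplaceTransform a A) (hb : HasLaplaceTransform b B) :
    HasLaplaceTransform (fun t => a t - b t) (fun s => A s - B s) := by
  simpa only [neg_one_mul, ← sub_eq_add_neg] using ha.add (hb.const_mul (-1))

theorem ae_eq (ha : HasLaplaceTransform a A) (hb : HasLaplaceTransform b A) :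
    ∀ᵐ t ∂(volume.restrict (Ioi (0 : ℝ))), a t = b t := by
  have h := (ha.sub hb).congr_right (B := fun _ => 0) fun s _ => sub_self _
  filter_upwards [ae_eq_zero_of_laplaceTransform h] with t ht using sub_eq_zero.1 ht

theorem of_integrableOn (ha : IntegrableOn a (Ioi 0)) :
    HasLaplaceTransform a (laplaceTransform a) :=
  fun _ hs => ⟨integrableOn_exp_mul ha hs.le, rfl⟩

theorem one : HasLaplaceTransform (fun _ => 1) (fun s => 1 / s) := fun s hs => by
  simp only [laplaceTransform, mul_one]
  refine ⟨integrableOn_exp_neg_mul_Ioi hs 0, ?_⟩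
  rw [integral_exp_neg_mul_Ioi hs 0]
  simp

/-- Tilting both factors by e^{-t} makes them integrable on the half-line, where convolutions exist
almost everywhere; the tilts recombine into e^{-t}, constant in τ. -/
theorem ae_intervalIntegrable_conv (ha : HasLaplaceTransform a A) (hb : HasLaplaceTransform b B) :
    ∀ᵐ t ∂(volume.restrict (Ioi (0 : ℝ))),
      IntervalIntegrable (fun τ => a (t - τ) * b τ) volume 0 t := by
  have h1 := (integrable_indicator_iff measurableSet_Ioi).2 (hb 1 one_pos).1
  have h2 := (integrable_indicator_iff measurableSet_Ioi).2 (ha 1 one_pos).1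
  have h3 := h1.ae_convolution_exists (ContinuousLinearMap.mul ℝ ℝ) h2
  filter_upwards [ae_restrict_of_ae h3, ae_restrict_mem measurableSet_Ioi] with t ht ht0
  rw [mem_Ioi] at ht0
  rw [intervalIntegrable_iff_integrableOn_Ioo_of_le ht0.le]
  have h4 : IntegrableOn _ (Ioo 0 t) := (Integrable.integrableOn ht).const_mul (Real.exp t)
  refine h4.congr_fun (fun τ hτ => ?_) measurableSet_Ioo
  simp only [ContinuousLinearMap.mul_apply']
  rw [indicator_of_mem (mem_Ioi.2 hτ.1), indicator_of_mem (mem_Ioi.2 (sub_pos.2 hτ.2))]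
  have : Real.exp t * (Real.exp (-(1 * τ)) * b τ * (Real.exp (-(1 * (t - τ))) * a (t - τ)))
      = Real.exp t * Real.exp (-(1 * τ)) * Real.exp (-(1 * (t - τ))) * (a (t - τ) * b τ) := by ring
  rw [this, ← Real.exp_add, ← Real.exp_add, show t + -(1 * τ) + -(1 * (t - τ)) = 0 by ring,
    Real.exp_zero, one_mul]

theorem conv (ha : HasLaplaceTransform a A) (hb : HasLaplaceTransform b B) :
    HasLaplaceTransform (fun t => ∫ τ in (0 : ℝ)..t, a (t - τ) * b τ) (fun s => A s * B s) := by
  intro s hs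
  have e : ∀ x, ∫ τ in (0 : ℝ)..x, (ContinuousLinearMap.mul ℝ ℝ) (Real.exp (-(s * τ)) * b τ)
      (Real.exp (-(s * (x - τ))) * a (x - τ))
      = Real.exp (-(s * x)) * ∫ τ in (0 : ℝ)..x, a (x - τ) * b τ := fun x => by
    rw [← intervalIntegral.integral_const_mul]
    refine intervalIntegral.integral_congr fun τ _ => ?_
    simp only [ContinuousLinearMap.mul_apply']
    rw [show -(s * x) = -(s * τ) + -(s * (x - τ)) by ring, Real.exp_add]
    ring
  have h1 := integrable_posConvolution (hb s hs).1 (ha s hs).1 (ContinuousLinearMap.mul ℝ ℝ)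
  have h2 := integral_posConvolution (hb s hs).1 (ha s hs).1 (ContinuousLinearMap.mul ℝ ℝ)
  simp_rw [e] at h2
  refine ⟨?_, ?_⟩
  · refine h1.integrableOn.congr_fun (fun x hx => ?_) measurableSet_Ioi
    rw [posConvolution, indicator_of_mem hx]
    exact e x
  · unfold laplaceTransform
    rw [h2, ContinuousLinearMap.mul_apply', mul_comm]
    exact congrArg₂ _ (ha s hs).2 (hb s hs).2

end HasLaplaceTransform

/-! ### The relaxation equation: existence and uniqueness -/

section Relaxation

variable {g φ f : ℝ → ℝ} {lam : ℝ}

theorem hasLaplaceTransform_primitive {A : ℝ → ℝ} (hf : HasLaplaceTransform f A) :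
    HasLaplaceTransform (fun t => ∫ τ in (0 : ℝ)..t, f τ) (fun s => 1 / s * A s) := by
  simpa using HasLaplaceTransform.one.conv hf

theorem hasLaplaceTransform_relaxation (hpos : ∀ x, 0 < x → 0 < g x) (hlam : 0 < lam)
    (hf : HasLaplaceTransform f fun s => lam / (lam + g s)) :
    HasLaplaceTransform (fun t => 1 - ∫ τ in (0 : ℝ)..t, f τ)
      (fun s => g s / s / (lam + g s)) := by
  refine (HasLaplaceTransform.one.sub (hasLaplaceTransform_primitive hf)).congr_right fun s hs => ?_
  have := (add_pos hlam (hpos s hs)).ne'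
  field_simp
  ring

/-- The convolution of φ with -f and the function -lam u have the same transform, so they agree
almost everywhere; u' = -f almost everywhere by Lebesgue differentiation. -/
theorem isRelaxationSolution (hpos : ∀ x, 0 < x → 0 < g x) (hlam : 0 < lam)
    (hφ : HasLaplaceTransform φ fun s => g s / s) (hfi : Integrable f)
    (hf : HasLaplaceTransform f fun s => lam / (lam + g s)) :
    IsRelaxationSolution φ lam (fun t => 1 - ∫ τ in (0 : ℝ)..t, f τ) := by
  refine ⟨fun T hT => ?_, by simp, ?_⟩
  · have h1 : AbsolutelyContinuousOnInterval (fun _ : ℝ => (1 : ℝ)) 0 T :=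
      (contDiffOn_const (n := 1)).absolutelyContinuousOnInterval
    exact h1.sub (hfi.intervalIntegrable.absolutelyContinuousOnInterval_intervalIntegral (by simp))
  · have hder : ∀ᵐ τ : ℝ, deriv (fun t => 1 - ∫ τ in (0 : ℝ)..t, f τ) τ = -1 * f τ := by
      filter_upwards [LocallyIntegrable.ae_hasDerivAt_integral hfi.locallyIntegrable] with τ hτ
      rw [((hτ 0).const_sub 1).deriv, neg_one_mul]
    have hnf := hf.const_mul (-1)
    have heq := (hφ.conv hnf).ae_eq
      (((hasLaplaceTransform_relaxation hpos hlam hf).const_mul (-lam)).congr_right fun s hs => by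
        have := (add_pos hlam (hpos s hs)).ne'
        field_simp)
    filter_upwards [heq, hφ.ae_intervalIntegrable_conv hnf] with t h1 h2
    have h3 : ∀ᵐ τ : ℝ, φ (t - τ) * (-1 * f τ)
        = φ (t - τ) * deriv (fun t => 1 - ∫ τ in (0 : ℝ)..t, f τ) τ := by
      filter_upwards [hder] with τ hτ
      rw [hτ]
    refine ⟨h2.congr_ae (ae_restrict_of_ae h3), ?_⟩
    rw [← h1, scarpiDeriv]
    exact (intervalIntegral.integral_congr_ae (h3.mono fun τ hτ _ => hτ)).symm

/-- No growth of `v` is assumed, so v' is truncated at `T`. The residual `q` of the equation then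
vanishes on (0, T] almost everywhere, and so does its causal convolution with `f`. -/
theorem IsRelaxationSolution.eqOn {v : ℝ → ℝ} (hpos : ∀ x, 0 < x → 0 < g x) (hlam : 0 < lam)
    (hφ : HasLaplaceTransform φ fun s => g s / s) (hfi : Integrable f)
    (hf : HasLaplaceTransform f fun s => lam / (lam + g s)) (hv : IsRelaxationSolution φ lam v) :
    EqOn v (fun t => 1 - ∫ τ in (0 : ℝ)..t, f τ) (Ici 0) := by
  intro t₀ ht₀
  rw [mem_Ici] at ht₀
  set T : ℝ := t₀ + 1 with hT
  have hT0 : 0 < T := by positivity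
  have hac := hv.absolutelyContinuous T hT0
  set z : ℝ → ℝ := (Ioc 0 T).indicator (deriv v) with hz
  have hzi : Integrable z := by
    rw [hz, integrable_indicator_iff measurableSet_Ioc,
      ← intervalIntegrable_iff_integrableOn_Ioc_of_le hT0.le]
    exact hac.intervalIntegrable_deriv
  have hzL := HasLaplaceTransform.of_integrableOn hzi.integrableOn
  have hzv : ∀ t ∈ Icc 0 T, ∫ τ in (0 : ℝ)..t, z τ = v t - 1 := by
    intro t ht
    rw [← hv.initial, ← (hac.mono (by
      rw [uIcc_of_le ht.1, uIcc_of_le hT0.le]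
      exact Icc_subset_Icc_right ht.2)).integral_deriv_eq_sub]
    refine intervalIntegral.integral_congr_ae (ae_of_all _ fun τ hτ => ?_)
    rw [uIoc_of_le ht.1] at hτ
    rw [hz, indicator_of_mem (show τ ∈ Ioc 0 T from ⟨hτ.1, hτ.2.trans ht.2⟩)]
  set q : ℝ → ℝ := fun t => (∫ τ in (0 : ℝ)..t, φ (t - τ) * z τ)
    + lam * (1 + ∫ τ in (0 : ℝ)..t, z τ) with hq
  have hqL : HasLaplaceTransform q (fun s => g s / s * laplaceTransform z s
      + lam * (1 / s + 1 / s * laplaceTransform z s)) :=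
    (hφ.conv hzL).add ((HasLaplaceTransform.one.add (hasLaplaceTransform_primitive hzL)).const_mul _)
  have hq0 : ∀ᵐ t ∂(volume.restrict (Ioi (0 : ℝ))), t ≤ T → q t = 0 := by
    filter_upwards [hv.equation, ae_restrict_mem measurableSet_Ioi] with t ht ht0 htT
    rw [mem_Ioi] at ht0
    have h1 : ∫ τ in (0 : ℝ)..t, φ (t - τ) * z τ = scarpiDeriv φ v t := by
      refine intervalIntegral.integral_congr_ae (ae_of_all _ fun τ hτ => ?_)
      rw [uIoc_of_le ht0.le] at hτ
      rw [hz, indicator_of_mem (show τ ∈ Ioc 0 T from ⟨hτ.1, hτ.2.trans htT⟩)]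
    simp only [hq]
    rw [h1, ht.2, hzv t ⟨ht0.le, htT⟩]
    ring
  -- Convolution with `f` inverts the equation: the transform of `q` is ((lam + g) z̃ + lam)/s, with
  -- z̃ that of `z`, so ∫z = lam⁻¹ (f ∗ q) - ∫f almost everywhere.
  have hkey := (hasLaplaceTransform_primitive hzL).ae_eq
    ((((hf.conv hqL).const_mul lam⁻¹).sub (hasLaplaceTransform_primitive hf)).congr_right
      fun s hs => by
        have := (add_pos hlam (hpos s hs)).ne'
        field_simp
        ring)
  have hae : v =ᵐ[volume.restrict (Icc 0 T)] fun t => 1 - ∫ τ in (0 : ℝ)..t, f τ := by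
    rw [Measure.restrict_congr_set Ioc_ae_eq_Icc.symm]
    have h1 := ae_restrict_of_ae_restrict_of_subset (Ioc_subset_Ioi_self : Ioc 0 T ⊆ Ioi 0) hkey
    filter_upwards [h1, ae_restrict_mem measurableSet_Ioc] with t ht htT
    have h2 : ∫ τ in (0 : ℝ)..t, f (t - τ) * q τ = 0 := by
      refine intervalIntegral.integral_zero_ae ?_
      rw [ae_restrict_iff' measurableSet_Ioi] at hq0
      filter_upwards [hq0] with τ hτ hτt
      rw [uIoc_of_le htT.1.le] at hτt
      rw [hτ hτt.1 (hτt.2.trans htT.2), mul_zero]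
    rw [hzv t ⟨htT.1.le, htT.2⟩, h2] at ht
    linarith
  have hcont : Continuous fun t => 1 - ∫ τ in (0 : ℝ)..t, f τ :=
    continuous_const.sub (intervalIntegral.continuous_primitive (fun _ _ => hfi.intervalIntegrable) 0)
  have hvc : ContinuousOn v (Icc 0 T) := by
    have := hac.continuousOn
    rwa [uIcc_of_le hT0.le] at this
  exact Measure.eqOn_Icc_of_ae_eq volume hT0.ne hae hvc hcont.continuousOn
    ⟨ht₀, by linarith⟩

theorem exists_density {μ : Measure ℝ} [IsProbabilityMeasure μ] (hμ0 : μ (Iio 0) = 0)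
    (hac : μ ≪ volume) :
    ∃ f : ℝ → ℝ, Integrable f ∧ HasLaplaceTransform f (measureLaplace μ) ∧
      ∀ t, 0 ≤ t → μ.real (Ioi t) = 1 - ∫ τ in (0 : ℝ)..t, f τ := by
  have hpos : ∀ᵐ t ∂μ, t ∈ Ioi 0 := by
    filter_upwards [ae_nonneg_of_measure_Iio hμ0, compl_mem_ae_iff.2 (hac Real.volume_singleton)]
      with t h1 (h2 : t ≠ 0) using lt_of_le_of_ne h1 h2.symm
  have hfi : Integrable (fun t => (μ.rnDeriv volume t).toReal) := Measure.integrable_toReal_rnDeriv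
  refine ⟨_, hfi, fun s hs => ⟨integrableOn_exp_mul hfi.integrableOn hs.le, ?_⟩, fun t ht => ?_⟩
  · unfold laplaceTransform measureLaplace
    have h1 : ∫ t, Real.exp (-(s * t)) ∂μ = ∫ t in Ioi 0, Real.exp (-(s * t)) ∂μ := by
      rw [Measure.restrict_eq_self_of_ae_mem hpos]
    rw [h1, ← integral_indicator measurableSet_Ioi, ← integral_indicator measurableSet_Ioi,
      ← integral_rnDeriv_smul hac]
    refine integral_congr_ae (ae_of_all _ fun t => ?_)
    by_cases h : t ∈ Ioi (0 : ℝ)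
    · simp only [indicator_of_mem h, smul_eq_mul, mul_comm]
    · simp only [indicator_of_notMem h, smul_zero]
  · rw [intervalIntegral.integral_of_le ht, Measure.setIntegral_toReal_rnDeriv hac]
    have h1 : μ.real (Ioi 0) = 1 := by
      rw [measureReal_def, (mem_ae_iff_prob_eq_one measurableSet_Ioi).1 hpos, ENNReal.toReal_one]
    rw [← h1, ← Ioc_union_Ioi_eq_Ioi ht,
      measureReal_union (Ioc_disjoint_Ioi le_rfl) measurableSet_Ioi]
    ring

end Relaxation

/-! ### Abelian limits of sA(s) -/

section Abelian

/-- Substituting x = st gives sA(s) = ∫ e^{-x} α(x/s) dx, and e^{-x} dominates. The general filter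
serves both s → ∞ and s → 0+. -/
theorem tendsto_mul_laplaceTransform {α : ℝ → ℝ} {c : ℝ} {l : Filter ℝ} [l.IsCountablyGenerated]
    (hα : ∀ t : ℝ, 0 ≤ t → α t ∈ Ioo (0 : ℝ) 1) (hloc : LocallyIntegrableOn α (Ici 0))
    (hl : ∀ᶠ s in l, 0 < s) (hlim : ∀ x, 0 < x → Tendsto (fun s => α (x / s)) l (𝓝 c)) :
    Tendsto (fun s => s * laplaceTransform α s) l (𝓝 c) := by
  have hnorm : ∀ t, 0 ≤ t → ‖α t‖ ≤ 1 := fun t ht => by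
    rw [Real.norm_of_nonneg (hα t ht).1.le]; exact (hα t ht).2.le
  have hms : AEStronglyMeasurable α (volume.restrict (Ioi 0)) :=
    hloc.aestronglyMeasurable.mono_measure (Measure.restrict_mono Ioi_subset_Ici_self le_rfl)
  have hint : ∀ s, 0 < s → IntegrableOn (fun x => Real.exp (-x) * α (x / s)) (Ioi 0) := by
    intro s hs
    have h1 : IntegrableOn (fun t => Real.exp (-(s * t)) * α (s * t / s)) (Ioi 0) := by
      simp_rw [mul_div_cancel_left₀ _ hs.ne']
      refine Integrable.mul_bdd (c := 1) (integrableOn_exp_neg_mul_Ioi hs 0) hms ?_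
      filter_upwards [ae_restrict_mem measurableSet_Ioi] with t ht using hnorm t (le_of_lt ht)
    have := (integrableOn_Ioi_comp_mul_left_iff
      (fun x => Real.exp (-x) * α (x / s)) 0 hs).1 h1
    rwa [mul_zero] at this
  have heq : ∀ s, 0 < s →
      ∫ x in Ioi 0, Real.exp (-x) * α (x / s) = s * laplaceTransform α s := by
    intro s hs
    have := integral_comp_mul_left_Ioi (fun x => Real.exp (-x) * α (x / s)) 0 hs
    simp_rw [mul_div_cancel_left₀ _ hs.ne', mul_zero] at this
    rw [laplaceTransform, this, smul_eq_mul, mul_inv_cancel_left₀ hs.ne']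
  have hc : c = ∫ x in Ioi 0, Real.exp (-x) * c := by
    rw [integral_mul_const, integral_exp_neg_Ioi_zero, one_mul]
  rw [hc]
  refine Tendsto.congr' (hl.mono fun s hs => heq s hs) ?_
  refine tendsto_integral_filter_of_dominated_convergence (fun x => Real.exp (-x)) ?_ ?_
    (integrableOn_exp_neg_Ioi 0) ?_
  · exact hl.mono fun s hs => (hint s hs).aestronglyMeasurable
  · filter_upwards [hl] with s hs
    filter_upwards [ae_restrict_mem measurableSet_Ioi] with x hx
    rw [norm_mul, Real.norm_of_nonneg (Real.exp_pos _).le]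
    exact mul_le_of_le_one_right (Real.exp_pos _).le (hnorm _ (div_nonneg (le_of_lt hx) hs.le))
  · filter_upwards [ae_restrict_mem measurableSet_Ioi] with x hx
    exact (hlim x hx).const_mul _

end Abelian

/-! ### Growth and limits of the symbol -/

section Symbol

variable {B : ℝ → ℝ} {β : ℝ}

theorem hasGrowthIndex_rpow (hB : Tendsto B atTop (𝓝 β)) : HasGrowthIndex (fun s => s ^ B s) β := by
  intro η hη
  filter_upwards [hB.eventually (Ioo_mem_nhds (show β - η < β by linarith)
    (show β < β + η by linarith)), eventually_ge_atTop 1] with s hs h1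
  exact ⟨Real.rpow_le_rpow_of_exponent_le h1 hs.1.le, Real.rpow_le_rpow_of_exponent_le h1 hs.2.le⟩

theorem HasGrowthIndex.tendsto_div {g : ℝ → ℝ} (hg : HasGrowthIndex g β) (hβ : β < 1)
    (hpos : ∀ x, 0 < x → 0 < g x) : Tendsto (fun s => g s / s) atTop (𝓝 0) := by
  have h := tendsto_rpow_neg_atTop (show 0 < (1 - β) / 2 by linarith)
  refine tendsto_of_tendsto_of_tendsto_of_le_of_le' tendsto_const_nhds h ?_ ?_
  · filter_upwards [eventually_gt_atTop 0] with s hs using (div_pos (hpos s hs) hs).le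
  · filter_upwards [hg ((1 - β) / 2) (by linarith), eventually_gt_atTop 0] with s hs h0
    rw [div_le_iff₀ h0]
    refine hs.2.trans_eq ?_
    rw [← Real.rpow_add_one h0.ne']
    ring_nf

theorem tendsto_rpow_nhdsGT_zero (hB : Tendsto B (𝓝[>] 0) (𝓝 β)) (hβ : 0 < β) :
    Tendsto (fun s => s ^ B s) (𝓝[>] 0) (𝓝 0) := by
  have h : Tendsto (fun s : ℝ => s ^ (β / 2)) (𝓝[>] 0) (𝓝 0) := by
    have := ((Real.continuous_rpow_const (half_pos hβ).le).tendsto 0).mono_left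
      (nhdsWithin_le_nhds (s := Ioi 0))
    rwa [Real.zero_rpow (half_pos hβ).ne'] at this
  refine tendsto_of_tendsto_of_tendsto_of_le_of_le' tendsto_const_nhds h ?_ ?_
  · filter_upwards [self_mem_nhdsWithin] with s hs using Real.rpow_nonneg (le_of_lt hs) _
  · filter_upwards [hB.eventually (Ioi_mem_nhds (half_lt_self hβ)), Ioo_mem_nhdsGT one_pos]
      with s hs h01
    exact Real.rpow_le_rpow_of_exponent_ge h01.1 h01.2.le (le_of_lt hs)

end Symbol
end

/-! ### The main theorem -/

theorem theorem1 (α : ℝ → ℝ) (α₁ α₂ lam : ℝ)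
    (hα : ∀ t : ℝ, 0 ≤ t → α t ∈ Ioo (0 : ℝ) 1)
    (hloc : LocallyIntegrableOn α (Ici 0))
    (hα₁ : α₁ ∈ Ioo (0 : ℝ) 1) (hα₂ : α₂ ∈ Ioo (0 : ℝ) 1)
    (hzero : Tendsto α (𝓝[>] 0) (𝓝 α₁))
    (htop : Tendsto α atTop (𝓝 α₂))
    (hB : IsBernsteinFunction (scarpiSymbol α))
    (hlam : 0 < lam) :
    -- the kernel of the variable-order derivative exists
    (∃ φ : ℝ → ℝ, IsScarpiKernel α φ) ∧
    ∀ φ : ℝ → ℝ, IsScarpiKernel α φ →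
      -- the relaxation equation has one and only one solution `u` on `[0, ∞)`
      ∃ u : ℝ → ℝ, IsRelaxationSolution φ lam u ∧
        (∀ v : ℝ → ℝ, IsRelaxationSolution φ lam v → EqOn v u (Ici 0)) ∧
        HasLaplaceTransform u (fun s =>
          s ^ (s * laplaceTransform α s - 1) / (lam + s ^ (s * laplaceTransform α s))) ∧
        (∀ t : ℝ, 0 ≤ t → 0 ≤ u t) ∧
        AntitoneOn u (Ici 0) ∧
        (∀ t : ℝ, 0 ≤ t → ContinuousWithinAt u (Ici t) t) ∧
        Tendsto u (𝓝[>] 0) (𝓝 1) ∧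
        -- `u` is the tail distribution of a positive random variable
        ∃ (Ω : Type) (_ : MeasurableSpace Ω) (P : Measure Ω) (Z : Ω → ℝ),
          IsProbabilityMeasure P ∧ Measurable Z ∧ (∀ x, 0 < Z x) ∧
          ∀ t : ℝ, 0 ≤ t → P.real {x | t < Z x} = u t := by
  set g := scarpiSymbol α with hg
  have hBtop : Tendsto (fun s => s * laplaceTransform α s) atTop (𝓝 α₁) := by
    refine tendsto_mul_laplaceTransform hα hloc (eventually_gt_atTop 0) fun x hx => hzero.comp ?_
    refine tendsto_nhdsWithin_iff.2 ⟨tendsto_const_nhds.div_atTop tendsto_id, ?_⟩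
    filter_upwards [eventually_gt_atTop 0] with s hs using div_pos hx hs
  have hBzero : Tendsto (fun s => s * laplaceTransform α s) (𝓝[>] 0) (𝓝 α₂) := by
    refine tendsto_mul_laplaceTransform hα hloc self_mem_nhdsWithin fun x hx => htop.comp ?_
    exact (tendsto_inv_nhdsGT_zero.const_mul_atTop hx).congr fun s => (div_eq_mul_inv x s).symm
  have hpos : ∀ x, 0 < x → 0 < g x := fun x hx => Real.rpow_pos_of_pos hx _
  have hgr : HasGrowthIndex g α₁ := hasGrowthIndex_rpow hBtop
  have hg0 : Tendsto g (𝓝[>] 0) (𝓝 0) := tendsto_rpow_nhdsGT_zero hBzero hα₂.1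
  have hgs : ∀ s, 0 < s → s ^ (s * laplaceTransform α s - 1) = g s / s :=
    fun s hs => Real.rpow_sub_one hs.ne' _
  refine ⟨?_, fun φ hφ => ?_⟩
  · obtain ⟨φ, hφ⟩ := hB.exists_kernel hg0 (hgr.tendsto_div hα₁.2 hpos)
    exact ⟨φ, hφ.congr_right fun s hs => (hgs s hs).symm⟩
  obtain ⟨μ, hμ, hμ0, hμac, hμL⟩ := exists_resolvent hB hpos hg0 hgr hα₁ hlam
  obtain ⟨f, hfi, hfL, hfμ⟩ := exists_density hμ0 hμac
  have hf : HasLaplaceTransform f fun s => lam / (lam + g s) := hfL.congr_right hμL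
  have hφ' : HasLaplaceTransform φ fun s => g s / s := HasLaplaceTransform.congr_right hφ hgs
  have hcont : Continuous fun t => 1 - ∫ τ in (0 : ℝ)..t, f τ :=
    continuous_const.sub (intervalIntegral.continuous_primitive (fun _ _ => hfi.intervalIntegrable) 0)
  refine ⟨fun t => 1 - ∫ τ in (0 : ℝ)..t, f τ, isRelaxationSolution hpos hlam hφ' hfi hf,
    fun v hv => hv.eqOn hpos hlam hφ' hfi hf,
    (hasLaplaceTransform_relaxation hpos hlam hf).congr_right fun s hs => by rw [hgs s hs]; rfl,
    fun t ht => ?_, fun s hs t ht hst => ?_, fun t _ => hcont.continuousWithinAt, ?_,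
    -- The identity on (ℝ, μ) is changed to 1 on the null set x ≤ 0, since positivity is required at
    -- every point.
    ℝ, inferInstance, μ, fun x => if 0 < x then x else 1, hμ,
    Measurable.ite measurableSet_Ioi measurable_id measurable_const, fun x => ?_, fun t ht => ?_⟩
  · simp only [← hfμ t ht, measureReal_nonneg]
  · simp only [← hfμ s hs, ← hfμ t ht]
    exact measureReal_mono (Ioi_subset_Ioi hst)
  · simpa using (hcont.tendsto 0).mono_left (nhdsWithin_le_nhds (s := Ioi 0))
  · beta_reduce
    split_ifs with h
    exacts [h, one_pos]
  · simp only [← hfμ t ht]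
    refine measureReal_congr ?_
    filter_upwards [ae_nonneg_of_measure_Iio hμ0,
      compl_mem_ae_iff.2 (hμac Real.volume_singleton)] with x h1 (h2 : x ≠ 0)
    refine propext ?_
    change (t < if 0 < x then x else 1) ↔ t < x
    rw [if_pos (lt_of_le_of_ne h1 h2.symm)]
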